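/- Let $\pi$ be a group, and let $X$ be a path-connected space with base point $x_0$ that has the homotopy type of a CW complex and is an Eilenberg--Mac Lane space $K(\pi,1)$, i.e. $\pi_1(X,x_0)$ is identified with $\pi$ by an isomorphism and $\pi_m(X,x_0)=0$ for all $m\ge 2$. For a based map $f\colon (A,a_0)\to (X,x_0)$, where $A$ is a path-connected space with the homotopy type of a CW complex, the first generalized Gottlieb group $G_1^f(X)$ is the subgroup of $\pi_1(X,x_0)$ consisting of all elements that can be represented by a based map $\alpha\colon\mathbb S^1\to X$ such that $f\vee\alpha\colon A\vee\mathbb S^1\to X$ extends, up to based homotopy, to a map $F\colon A\times\mathbb S^1\to X$. The first Gottlieb group is $G_1(X)=G_1^{\mathrm{id}_X}(X)$. Then for every such $A$ and every such $f$, $$G_1^f(X)=\mathcal Z_\pi\, f_*(\pi_1(A,a_0)),$$ the centralizer in $\pi$ of the subgroup $f_*(\pi_1(A,a_0))$. In particular, $G_1(X)=\mathcal Z\pi$, the center of $\pi$. -/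

import Mathlib

open scoped Topology unitInterval

noncomputable section

namespace GenGottlieb

/-- A space has the homotopy type of a CW complex: it is homotopy equivalent to a Hausdorff space
that carries a CW structure. -/
def HasCWHomotopyType.{u} (X : Type u) [TopologicalSpace X] : Prop :=
  ∃ (Y : Type u) (_ : TopologicalSpace Y), T2Space Y ∧
    Nonempty (Topology.CWComplex (Set.univ : Set Y)) ∧
    Nonempty (ContinuousMap.HomotopyEquiv X Y)

/-- `X` with base point `x₀` is an Eilenberg-Mac Lane space `K(π, 1)`: it is path-connected, its
fundamental group is identified with `π`, and its higher homotopy groups are trivial. -/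
structure EilenbergMacLaneOne (π : Type*) [Group π] (X : Type*) [TopologicalSpace X] (x₀ : X) where
  pathConnected : PathConnectedSpace X
  iso : FundamentalGroup X x₀ ≃* π
  higher : ∀ m : ℕ, 2 ≤ m → Subsingleton (HomotopyGroup.Pi m X x₀)

/-- The standard parametrization `t ↦ exp (2πit)` of the circle by the unit interval. -/
def circleParam : C(I, Circle) where
  toFun t := Circle.exp (2 * Real.pi * (t : ℝ))
  continuous_toFun := by fun_prop

theorem circleParam_zero : circleParam 0 = 1 := by simp [circleParam]

theorem circleParam_one : circleParam 1 = 1 := by simp [circleParam]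

theorem circleParam_surjective : Function.Surjective circleParam := by
  intro z
  have hz : ∃ t : ℝ, z = Circle.exp t := by
    obtain ⟨t, ht⟩ := Circle.exp_surjective z
    exact ⟨t, ht.symm⟩
  obtain ⟨t, rfl⟩ := hz
  refine ⟨⟨Int.fract (t / (2 * Real.pi)), Int.fract_nonneg _, (Int.fract_lt_one _).le⟩, ?_⟩
  have hp : (2 * Real.pi) ≠ 0 := by positivity
  change Circle.exp _ = _
  rw [Circle.exp_eq_exp]
  refine ⟨-⌊t / (2 * Real.pi)⌋, ?_⟩
  simp only [Int.fract]
  push_cast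
  field_simp
  ring

theorem circleParam_eq {s t : I} (h : circleParam s = circleParam t) :
    s = t ∨ (s = 0 ∧ t = 1) ∨ (s = 1 ∧ t = 0) := by
  change Circle.exp _ = Circle.exp _ at h
  rw [Circle.exp_eq_exp] at h
  obtain ⟨m, hm⟩ := h
  have hp : (0 : ℝ) < 2 * Real.pi := by positivity
  have hm' : (s : ℝ) = t + m := by
    have : 2 * Real.pi * (s : ℝ) = 2 * Real.pi * (t + m) := by rw [hm]; ring
    exact mul_left_cancel₀ hp.ne' this
  have hs0 := s.2.1
  have hs1 := s.2.2
  have ht0 := t.2.1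
  have ht1 := t.2.2
  have h1 : (m : ℝ) ≤ 1 := by linarith
  have h2 : (-1 : ℝ) ≤ m := by linarith
  have h1' : m ≤ 1 := by exact_mod_cast h1
  have h2' : -1 ≤ m := by exact_mod_cast h2
  interval_cases m
  · right; left
    push_cast at hm'
    exact ⟨Subtype.ext (by change (s : ℝ) = 0; linarith), Subtype.ext (by change (t : ℝ) = 1; linarith)⟩
  · left
    exact Subtype.ext (by simpa using hm')
  · right; right
    push_cast at hm'
    exact ⟨Subtype.ext (by change (s : ℝ) = 1; linarith), Subtype.ext (by change (t : ℝ) = 0; linarith)⟩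

section

variable {A X : Type*} [TopologicalSpace A] [TopologicalSpace X] {a₀ : A} {x₀ : X}

/-- The loop in `X` traced by a based map `α : (S¹, 1) → (X, x₀)`. -/
def loopOf (α : C(Circle, X)) (hα : α 1 = x₀) : Path x₀ x₀ where
  toContinuousMap := α.comp circleParam
  source' := by simp [circleParam_zero, hα]
  target' := by simp [circleParam_one, hα]

/-- The element of `π₁(X, x₀)` represented by a based map `α : (S¹, 1) → (X, x₀)`. -/
def classOf (α : C(Circle, X)) (hα : α 1 = x₀) : FundamentalGroup X x₀ :=
  FundamentalGroup.fromPath (Path.Homotopic.Quotient.mk (loopOf α hα))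

/-- For based maps `f : A → X` and `α : S¹ → X`, the map `f ∨ α : A ∨ S¹ → X` extends, up to based
homotopy, to a map `F : A × S¹ → X`. A based homotopy between maps out of the wedge is a pair of
based homotopies, one between the restrictions to `A` and one between the restrictions to `S¹`. -/
def WedgeExtends (a₀ : A) (f : C(A, X)) (α : C(Circle, X)) : Prop :=
  ∃ F : C(A × Circle, X),
    (F.comp ((ContinuousMap.id A).prodMk (ContinuousMap.const A 1))).HomotopicRel f {a₀} ∧
    (F.comp ((ContinuousMap.const Circle a₀).prodMk (ContinuousMap.id Circle))).HomotopicRel α {1}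

/-- The elements of `π₁(X, x₀)` represented by some `α : S¹ → X` such that `f ∨ α` extends up to
homotopy to `A × S¹`. -/
def gottliebSet (f : C(A, X)) (_hf : f a₀ = x₀) : Set (FundamentalGroup X x₀) :=
  {γ | ∃ (α : C(Circle, X)) (hα : α 1 = x₀), classOf α hα = γ ∧ WedgeExtends a₀ f α}

/-- The projection `A × [0, 1] → A × S¹` is a quotient map. -/
theorem isQuotientMap_param (A : Type*) [TopologicalSpace A] :
    Topology.IsQuotientMap ((ContinuousMap.id A).prodMap circleParam) := by
  have hp : IsProperMap circleParam := circleParam.continuous.isProperMap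
  have h : IsProperMap (Prod.map (id : A → A) circleParam) :=
    (Homeomorph.refl A).isProperMap.prodMap hp
  exact h.isClosedMap.isQuotientMap h.continuous
    (Function.surjective_id.prodMap circleParam_surjective)

theorem evalAt_trans {f g h : C(A, X)} (H : f.Homotopy g) (K : g.Homotopy h) (a : A) :
    (H.trans K).evalAt a = (H.evalAt a).trans (K.evalAt a) := by
  ext t
  simp only [ContinuousMap.Homotopy.evalAt_apply, ContinuousMap.Homotopy.trans_apply,
    Path.trans_apply]

/-- Membership in terms of self-homotopies of `f` and the loops that they trace at `a₀`. -/
theorem mem_gottliebSet_iff (f : C(A, X)) (hf : f a₀ = x₀) (γ : FundamentalGroup X x₀) :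
    γ ∈ gottliebSet f hf ↔ ∃ H : ContinuousMap.Homotopy f f,
      FundamentalGroup.fromPath
        (Path.Homotopic.Quotient.mk ((H.evalAt a₀).cast hf.symm hf.symm)) = γ := by
  subst hf
  constructor
  · rintro ⟨α, hα, rfl, F, ⟨h⟩, ⟨k⟩⟩
    let f' : C(A, X) := F.comp ((ContinuousMap.id A).prodMk (ContinuousMap.const A 1))
    let G : ContinuousMap.Homotopy f' f' :=
      { toContinuousMap := F.comp
          (((ContinuousMap.id A).prodMap circleParam).comp ContinuousMap.prodSwap)
        map_zero_left := fun a => by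
          change F (a, circleParam 0) = F (a, 1)
          rw [circleParam_zero]
        map_one_left := fun a => by
          change F (a, circleParam 1) = F (a, 1)
          rw [circleParam_one] }
    have h0 : f' a₀ = f a₀ := h.fst_eq_snd rfl
    have hh : h.toHomotopy.evalAt a₀ = (Path.refl (f a₀)).cast h0 rfl := by
      ext t
      exact h.eq_snd t rfl
    refine ⟨(h.symm.toHomotopy.trans G).trans h.toHomotopy, ?_⟩
    have h1 : h.symm.toHomotopy.evalAt a₀ = (Path.refl (f a₀)).cast rfl h0 := by
      ext t
      exact h.symm.eq_fst t rfl
    rw [evalAt_trans, evalAt_trans, hh, h1]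
    have e : (((((Path.refl (f a₀)).cast rfl h0).trans (G.evalAt a₀)).trans
        ((Path.refl (f a₀)).cast h0 rfl)).cast rfl rfl : Path (f a₀) (f a₀)) =
        ((Path.refl (f a₀)).trans ((G.evalAt a₀).cast h0.symm h0.symm)).trans
          (Path.refl (f a₀)) := by
      ext t
      simp [Path.trans_apply]
    have hom : ((G.evalAt a₀).cast h0.symm h0.symm).Homotopic (loopOf α hα) := by
      refine ⟨⟨⟨k.toContinuousMap.comp ((ContinuousMap.id I).prodMap circleParam), ?_, ?_⟩, ?_⟩⟩
      · intro t
        exact k.apply_zero _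
      · intro t
        exact k.apply_one _
      · rintro t y (rfl | rfl)
        · change k (t, circleParam 0) = F (a₀, circleParam 0)
          rw [circleParam_zero]
          exact k.eq_fst t rfl
        · change k (t, circleParam 1) = F (a₀, circleParam 1)
          rw [circleParam_one]
          exact k.eq_fst t rfl
    rw [e]
    exact Path.Homotopic.Quotient.eq.2
      ((Path.Homotopic.trans ⟨Path.Homotopy.transRefl _⟩
        ⟨Path.Homotopy.reflTrans _⟩).trans hom)
  · rintro ⟨H, rfl⟩
    have hfac : Function.FactorsThrough (H.toContinuousMap.comp ContinuousMap.prodSwap)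
        ((ContinuousMap.id A).prodMap circleParam) := by
      rintro ⟨a, s⟩ ⟨b, t⟩ hab
      obtain ⟨rfl, hst⟩ : a = b ∧ circleParam s = circleParam t := Prod.ext_iff.1 hab
      change H (s, a) = H (t, a)
      rcases circleParam_eq hst with rfl | ⟨rfl, rfl⟩ | ⟨rfl, rfl⟩ <;> simp
    let F : C(A × Circle, X) := (isQuotientMap_param A).lift _ hfac
    have hF : ∀ a t, F (a, circleParam t) = H (t, a) := fun a t =>
      DFunLike.congr_fun ((isQuotientMap_param A).lift_comp _ hfac) (a, t)
    have hF1 : ∀ a, F (a, 1) = f a := fun a => by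
      rw [← circleParam_zero, hF, H.apply_zero]
    refine ⟨F.comp ((ContinuousMap.const Circle a₀).prodMk (ContinuousMap.id Circle)), hF1 a₀,
      ?_, F, ?_, ContinuousMap.HomotopicRel.refl _⟩
    · refine congrArg (fun p => FundamentalGroup.fromPath (Path.Homotopic.Quotient.mk p)) ?_
      ext t
      exact hF a₀ t
    · have : F.comp ((ContinuousMap.id A).prodMk (ContinuousMap.const A 1)) = f := by
        ext a
        exact hF1 a
      rw [this]
      exact ContinuousMap.HomotopicRel.refl _

/-- The first generalized Gottlieb group `G₁^f(X)` of a based map `f : (A, a₀) → (X, x₀)`: the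
subgroup of `π₁(X, x₀)` of all elements represented by some `α : S¹ → X` such that
`f ∨ α : A ∨ S¹ → X` extends up to homotopy to `A × S¹`. -/
def generalizedGottliebGroup (f : C(A, X)) (hf : f a₀ = x₀) :
    Subgroup (FundamentalGroup X x₀) where
  carrier := gottliebSet f hf
  one_mem' := by
    rw [mem_gottliebSet_iff]
    subst hf
    exact ⟨ContinuousMap.Homotopy.refl f, rfl⟩
  mul_mem' := by
    intro p q hp hq
    rw [mem_gottliebSet_iff] at *
    obtain ⟨H, rfl⟩ := hp
    obtain ⟨K, rfl⟩ := hq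
    subst hf
    refine ⟨K.trans H, ?_⟩
    rw [evalAt_trans]
    rfl
  inv_mem' := by
    intro p hp
    rw [mem_gottliebSet_iff] at *
    obtain ⟨H, rfl⟩ := hp
    subst hf
    exact ⟨H.symm, rfl⟩

/-- The first Gottlieb group `G₁(X)`, the case `f = id`. -/
def gottliebGroup (X : Type*) [TopologicalSpace X] (x₀ : X) : Subgroup (FundamentalGroup X x₀) :=
  generalizedGottliebGroup (a₀ := x₀) (ContinuousMap.id X) rfl

end

end GenGottlieb

end

namespace GenGottlieb

open Metric

/-! ### Filling squares from homotopies of paths -/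

section Square

variable {X : Type*} [TopologicalSpace X]

/-! By `mem_gottliebSet_iff`, a class lies in the Gottlieb group exactly when some self-homotopy of
`f` traces it at `a₀`. Applying such a homotopy to a loop `l` in `A` gives a map of a square, so the
traced class commutes with `f_* l`; this is the easy inclusion.

Conversely, a self-homotopy of `f` is a continuous choice, for each point `a`, of a loop at `f a`.
Let `d` commute with the image of `f_*`. Conjugating `d` along the image of a path from `a₀` to `a`
gives a class at `f a` that does not depend on the path (`comp_push_eq_of_exists`), and
`IsTransported` asks the loop at `f a` to lie in this class. On a CW complex the loops are chosen
cell by cell (`exists_section_of_cells`). Over a vertex any representative will do. Over an edge the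
loops at its ends are conjugate along the edge, which is what is needed to fill a square. Over an
`n`-cell with `n ≥ 2` the data live on the boundary of a cylinder, an `n`-sphere, and extend because
`π_n(X) = 0` (`exists_filler_of_pi`).

A space that only has the homotopy type of a CW complex is handled by transferring the self-homotopy
along a homotopy equivalence and conjugating by the trace of the homotopy to the identity. -/

theorem exists_bigon_collapse : ∃ Q : C(I × I, I × I), Function.Surjective Q ∧
    (∀ r τ r' τ' : I, Q (r, τ) = Q (r', τ') →
      τ = τ' ∧ (r = r' ∨ τ = 0 ∨ τ = 1)) ∧
    ∀ r τ : I,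
      ((Q (r, τ)).1 : ℝ) = (1 - r) * min (2 * (τ : ℝ)) 1 + r * max (2 * (τ : ℝ) - 1) 0 ∧
      ((Q (r, τ)).2 : ℝ) = (1 - r) * max (2 * (τ : ℝ) - 1) 0 + r * min (2 * (τ : ℝ)) 1 := by
  have hmin : ∀ τ : I, min (2 * (τ : ℝ)) 1 ∈ I := fun τ =>
    ⟨le_min (by linarith [τ.2.1]) zero_le_one, min_le_right _ _⟩
  have hmax : ∀ τ : I, max (2 * (τ : ℝ) - 1) 0 ∈ I := fun τ =>
    ⟨le_max_right _ _, max_le (by linarith [τ.2.2]) zero_le_one⟩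
  have hconv : ∀ (r : I) {a b : ℝ}, a ∈ I → b ∈ I → (1 - r) * a + r * b ∈ I := fun r a b ha hb =>
    (convex_Icc (0 : ℝ) 1) ha hb (by linarith [r.2.2]) r.2.1 (by ring)
  -- At time `τ`, interpolate linearly between the bottom-right and the left-top edge paths from
  -- `(0, 0)` to `(1, 1)`. The coordinates sum to `2τ`, so the image determines `τ`; it determines
  -- `r` too unless the two edge points coincide.
  let Q : C(I × I, I × I) :=
    { toFun := fun x => (⟨_, hconv x.1 (hmin x.2) (hmax x.2)⟩, ⟨_, hconv x.1 (hmax x.2) (hmin x.2)⟩)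
      continuous_toFun := by fun_prop }
  have hsum : ∀ τ : I, min (2 * (τ : ℝ)) 1 + max (2 * (τ : ℝ) - 1) 0 = 2 * τ := fun τ => by
    rcases le_total (2 * (τ : ℝ)) 1 with h | h
    · rw [min_eq_left h, max_eq_right (by linarith)]; ring
    · rw [min_eq_right h, max_eq_left (by linarith)]; ring
  have hdiff : ∀ τ : I, min (2 * (τ : ℝ)) 1 - max (2 * (τ : ℝ) - 1) 0 = 0 → τ = 0 ∨ τ = 1 := by
    intro τ h0
    rcases le_total (2 * (τ : ℝ)) 1 with h | h
    · rw [min_eq_left h, max_eq_right (by linarith)] at h0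
      exact Or.inl (Subtype.ext (by change (τ : ℝ) = 0; linarith))
    · rw [min_eq_right h, max_eq_left (by linarith)] at h0
      exact Or.inr (Subtype.ext (by change (τ : ℝ) = 1; linarith))
  refine ⟨Q, ?_, ?_, fun r τ => ⟨rfl, rfl⟩⟩
  · rintro ⟨s, t⟩
    obtain ⟨τ, hτ⟩ : ∃ τ : I, (τ : ℝ) = (s + t) / 2 :=
      ⟨⟨(s + t) / 2, by linarith [s.2.1, t.2.1], by linarith [s.2.2, t.2.2]⟩, rfl⟩
    have hm : |(s : ℝ) - t| ≤ min (2 * (τ : ℝ)) 1 - max (2 * (τ : ℝ) - 1) 0 := by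
      have := s.2.1; have := s.2.2; have := t.2.1; have := t.2.2
      rw [abs_le]
      rcases le_total (2 * (τ : ℝ)) 1 with h | h
      · rw [min_eq_left h, max_eq_right (by linarith)]; constructor <;> linarith
      · rw [min_eq_right h, max_eq_left (by linarith)]; constructor <;> linarith
    have hs := hsum τ
    set m := min (2 * (τ : ℝ)) 1
    set M := max (2 * (τ : ℝ) - 1) 0
    have hm0 : 0 ≤ m - M := (abs_nonneg _).trans hm
    have hd : |((s : ℝ) - t) / (m - M)| ≤ 1 := by
      rw [abs_div, abs_of_nonneg hm0]
      exact div_le_one_of_le₀ hm hm0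
    -- At the two corners `m - M = 0`; division by zero then gives `r = 1/2`, which is harmless
    -- since `hm` forces `s = t`.
    have hd' : ((s : ℝ) - t) / (m - M) * (m - M) = s - t := by
      by_cases h : m - M = 0
      · rw [h] at hm ⊢
        rw [mul_zero, abs_nonpos_iff.1 hm]
      · exact div_mul_cancel₀ _ h
    rw [abs_le] at hd
    refine ⟨(⟨(1 - ((s : ℝ) - t) / (m - M)) / 2, by linarith, by linarith⟩, τ), ?_⟩
    refine Prod.ext (Subtype.ext ?_) (Subtype.ext ?_)
    · change (1 - (1 - ((s : ℝ) - t) / (m - M)) / 2) * m + (1 - ((s : ℝ) - t) / (m - M)) / 2 * M = s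
      linear_combination (1 / 2) * hd' + hs / 2 + hτ
    · change (1 - (1 - ((s : ℝ) - t) / (m - M)) / 2) * M + (1 - ((s : ℝ) - t) / (m - M)) / 2 * m = t
      linear_combination (-1 / 2) * hd' + hs / 2 + hτ
  · intro r τ r' τ' h
    have h1 : (1 - r) * min (2 * (τ : ℝ)) 1 + r * max (2 * (τ : ℝ) - 1) 0 =
        (1 - r') * min (2 * (τ' : ℝ)) 1 + r' * max (2 * (τ' : ℝ) - 1) 0 :=
      congrArg Subtype.val (congrArg Prod.fst h)
    have h2 : (1 - r) * max (2 * (τ : ℝ) - 1) 0 + r * min (2 * (τ : ℝ)) 1 =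
        (1 - r') * max (2 * (τ' : ℝ) - 1) 0 + r' * min (2 * (τ' : ℝ)) 1 :=
      congrArg Subtype.val (congrArg Prod.snd h)
    have hτ : τ = τ' := Subtype.ext (by linear_combination (h1 + h2 - hsum τ + hsum τ') / 2)
    subst hτ
    refine ⟨rfl, ?_⟩
    have h3 : ((r : ℝ) - r') * (min (2 * (τ : ℝ)) 1 - max (2 * (τ : ℝ) - 1) 0) = 0 := by
      linear_combination (h2 - h1) / 2
    rcases mul_eq_zero.1 h3 with h3 | h3
    · exact Or.inl (Subtype.ext (sub_eq_zero.1 h3))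
    · exact Or.inr (hdiff τ h3)

/-- A square whose two boundary paths from one corner to the opposite one are homotopic can be
filled. -/
theorem exists_square_filler {x₀₀ x₁₀ x₀₁ x₁₁ : X} {a : Path x₀₀ x₁₀} {d : Path x₁₀ x₁₁}
    {b : Path x₀₀ x₀₁} {c : Path x₀₁ x₁₁} (h : (a.trans d).Homotopic (b.trans c)) :
    ∃ k : C(I × I, X), (∀ s, k (s, 0) = a s) ∧ (∀ t, k (1, t) = d t) ∧ (∀ t, k (0, t) = b t) ∧
      ∀ s, k (s, 1) = c s := by
  obtain ⟨H⟩ := h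
  obtain ⟨Q, hQs, hQi, hQv⟩ := exists_bigon_collapse
  have hQ : Topology.IsQuotientMap Q :=
    Q.continuous.isClosedMap.isQuotientMap Q.continuous hQs
  have hfac : Function.FactorsThrough H.toContinuousMap Q := by
    rintro ⟨r, τ⟩ ⟨r', τ'⟩ hh
    obtain ⟨rfl, rfl | rfl | rfl⟩ := hQi _ _ _ _ hh
    · rfl
    · exact (H.source r).trans (H.source r').symm
    · exact (H.target r).trans (H.target r').symm
  have hk : ∀ x, hQ.lift H.toContinuousMap hfac (Q x) = H x := fun x =>
    DFunLike.congr_fun (hQ.lift_comp H.toContinuousMap hfac) x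
  have half : ∀ s : I, ∃ τ : I, (τ : ℝ) = s / 2 := fun s =>
    ⟨⟨s / 2, by linarith [s.2.1], by linarith [s.2.2]⟩, rfl⟩
  have half' : ∀ s : I, ∃ τ : I, (τ : ℝ) = (s + 1) / 2 := fun s =>
    ⟨⟨(s + 1) / 2, by linarith [s.2.1], by linarith [s.2.2]⟩, rfl⟩
  have key : ∀ (r τ : I) (y : I × I),
      (y.1 : ℝ) = (1 - r) * min (2 * (τ : ℝ)) 1 + r * max (2 * (τ : ℝ) - 1) 0 →
      (y.2 : ℝ) = (1 - r) * max (2 * (τ : ℝ) - 1) 0 + r * min (2 * (τ : ℝ)) 1 →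
      hQ.lift H.toContinuousMap hfac y = H (r, τ) := by
    intro r τ y h1 h2
    rw [← hk]
    congr 1
    exact Prod.ext (Subtype.ext (h1.trans (hQv r τ).1.symm))
      (Subtype.ext (h2.trans (hQv r τ).2.symm))
  refine ⟨hQ.lift H.toContinuousMap hfac, fun s => ?_, fun t => ?_, fun t => ?_, fun s => ?_⟩
  · obtain ⟨τ, hτ⟩ := half s
    have h1 := s.2.1; have h2 := s.2.2
    rw [key 0 τ, H.apply_zero]
    · change (a.trans d) τ = _
      rw [Path.trans_apply, dif_pos (by linarith)]
      exact congrArg a (Subtype.ext (by rw [Subtype.coe_mk]; linarith))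
    · rw [hτ, min_eq_left (by linarith)]; norm_num; ring
    · rw [hτ, max_eq_right (by linarith)]; norm_num
  · obtain ⟨τ, hτ⟩ := half' t
    have h1 := t.2.1; have h2 := t.2.2
    rw [key 0 τ, H.apply_zero]
    · change (a.trans d) τ = _
      rw [Path.trans_apply]
      -- At `τ = 1/2` the concatenation is evaluated on its first half, so the corner `t = 0` is
      -- read as the end of `a`.
      split_ifs with hh
      · have : t = 0 := Subtype.ext (by change (t : ℝ) = 0; linarith)
        subst this
        rw [d.source]
        exact (congrArg a (Subtype.ext (by rw [Subtype.coe_mk, hτ]; norm_num))).trans a.target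
      · exact congrArg d (Subtype.ext (by rw [Subtype.coe_mk]; linarith))
    · rw [hτ, min_eq_right (by linarith)]; norm_num
    · rw [hτ, max_eq_left (by linarith)]; norm_num; ring
  · obtain ⟨τ, hτ⟩ := half t
    have h1 := t.2.1; have h2 := t.2.2
    rw [key 1 τ, H.apply_one]
    · change (b.trans c) τ = _
      rw [Path.trans_apply, dif_pos (by linarith)]
      exact congrArg b (Subtype.ext (by rw [Subtype.coe_mk]; linarith))
    · rw [hτ, max_eq_right (by linarith)]; norm_num
    · rw [hτ, min_eq_left (by linarith)]; norm_num; ring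
  · obtain ⟨τ, hτ⟩ := half' s
    have h1 := s.2.1; have h2 := s.2.2
    rw [key 1 τ, H.apply_one]
    · change (b.trans c) τ = _
      rw [Path.trans_apply]
      split_ifs with hh
      · have : s = 0 := Subtype.ext (by change (s : ℝ) = 0; linarith)
        subst this
        rw [c.source]
        exact (congrArg b (Subtype.ext (by rw [Subtype.coe_mk, hτ]; norm_num))).trans b.target
      · exact congrArg c (Subtype.ext (by rw [Subtype.coe_mk]; linarith))
    · rw [hτ, max_eq_left (by linarith)]; norm_num; ring
    · rw [hτ, min_eq_right (by linarith)]; norm_num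

end Square

/-! ### The cylinder over a ball as a cone on its boundary -/

section Collapse

variable {E : Type*} [NormedAddCommGroup E] [NormedSpace ℝ E]

/-- The boundary of the cylinder over the closed unit ball. -/
def cylinderBoundary (E : Type*) [NormedAddCommGroup E] : Set (E × ℝ) :=
  {x | ‖x.1‖ ≤ 1 ∧ x.2 ∈ I ∧ (‖x.1‖ = 1 ∨ x.2 = 0 ∨ x.2 = 1)}

/-- A radial map from the closed unit ball onto the boundary of the cylinder over it. The inner
third covers the top, the middle third the side, the outer third the bottom, and the unit sphere
is collapsed to the center of the bottom. -/
noncomputable def cylinderCollapse (y : E) : E × ℝ :=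
  ((min 1 (3 * (1 - ‖y‖)) / max ‖y‖ (1 / 3)) • y, max 0 (min 1 (2 - 3 * ‖y‖)))

theorem continuous_cylinderCollapse : Continuous (cylinderCollapse : E → E × ℝ) := by
  have : ∀ y : E, max ‖y‖ (1 / 3) ≠ 0 := fun y =>
    (lt_of_lt_of_le (by norm_num) (le_max_right _ _)).ne'
  unfold cylinderCollapse
  fun_prop (disch := exact this _)

theorem cylinderCollapse_cases (y : E) :
    (‖y‖ ≤ 1 / 3 ∧ cylinderCollapse y = ((3 : ℝ) • y, 1)) ∨
    ((1 / 3 ≤ ‖y‖ ∧ ‖y‖ ≤ 2 / 3) ∧ cylinderCollapse y = ((1 / ‖y‖) • y, 2 - 3 * ‖y‖)) ∨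
    (2 / 3 ≤ ‖y‖ ∧ cylinderCollapse y = ((3 * (1 - ‖y‖) / ‖y‖) • y, 0)) := by
  unfold cylinderCollapse
  rcases le_total ‖y‖ (1 / 3) with h | h
  · left
    rw [min_eq_left (by linarith), max_eq_right h, min_eq_left (by linarith),
      max_eq_right zero_le_one]
    exact ⟨h, by norm_num⟩
  right
  rcases le_total ‖y‖ (2 / 3) with h' | h'
  · left
    rw [min_eq_left (by linarith), max_eq_left h, min_eq_right (by linarith),
      max_eq_right (by linarith)]
    exact ⟨⟨h, h'⟩, rfl⟩
  · right
    rw [min_eq_right (by linarith), max_eq_left h, min_eq_right (by linarith),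
      max_eq_left (by linarith)]
    exact ⟨h', rfl⟩

theorem norm_smul_div_norm {c : ℝ} (hc : 0 ≤ c) {y : E} (hy : 0 < ‖y‖) : ‖(c / ‖y‖) • y‖ = c := by
  rw [norm_smul, Real.norm_of_nonneg (by positivity), div_mul_cancel₀ _ hy.ne']

theorem cylinderCollapse_mem {y : E} (hy : ‖y‖ ≤ 1) :
    cylinderCollapse y ∈ cylinderBoundary E := by
  rcases cylinderCollapse_cases y with ⟨h, e⟩ | ⟨⟨h, h'⟩, e⟩ | ⟨h, e⟩ <;> rw [e]
  · refine ⟨?_, ⟨zero_le_one, le_rfl⟩, Or.inr (Or.inr rfl)⟩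
    change ‖(3 : ℝ) • y‖ ≤ 1
    rw [norm_smul, Real.norm_of_nonneg (by norm_num)]
    linarith
  · have := norm_smul_div_norm zero_le_one (y := y) (by linarith)
    exact ⟨this.le, ⟨by change 0 ≤ 2 - 3 * ‖y‖; linarith, by change 2 - 3 * ‖y‖ ≤ 1; linarith⟩,
      Or.inl this⟩
  · have := norm_smul_div_norm (c := 3 * (1 - ‖y‖)) (by linarith) (y := y) (by linarith)
    exact ⟨this.trans_le (by linarith), ⟨le_rfl, zero_le_one⟩, Or.inr (Or.inl rfl)⟩

theorem cylinderCollapse_of_norm_eq_one {y : E} (hy : ‖y‖ = 1) : cylinderCollapse y = (0, 0) := by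
  unfold cylinderCollapse
  rw [hy]
  norm_num

/-- The height and the norm of the first component together determine `‖y‖`. At a fixed radius the
first component is a fixed multiple of `y`, with nonzero factor below radius 1. -/
theorem cylinderCollapse_eq_iff {y y' : E} (hy : ‖y‖ ≤ 1) (hy' : ‖y'‖ ≤ 1)
    (h : cylinderCollapse y = cylinderCollapse y') : y = y' ∨ (‖y‖ = 1 ∧ ‖y'‖ = 1) := by
  have hn : ‖y‖ = ‖y'‖ := by
    have h1 : ‖(cylinderCollapse y).1‖ = ‖(cylinderCollapse y').1‖ := by rw [h]
    have h2 : (cylinderCollapse y).2 = (cylinderCollapse y').2 := by rw [h]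
    have key : ∀ {y : E}, ‖y‖ ≤ 1 →
        (‖y‖ ≤ 1 / 3 ∧ ‖(cylinderCollapse y).1‖ = 3 * ‖y‖ ∧ (cylinderCollapse y).2 = 1) ∨
        ((1 / 3 ≤ ‖y‖ ∧ ‖y‖ ≤ 2 / 3) ∧ ‖(cylinderCollapse y).1‖ = 1 ∧
          (cylinderCollapse y).2 = 2 - 3 * ‖y‖) ∨
        (2 / 3 ≤ ‖y‖ ∧ ‖(cylinderCollapse y).1‖ = 3 * (1 - ‖y‖) ∧
          (cylinderCollapse y).2 = 0) := by
      intro y hy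
      refine (cylinderCollapse_cases y).imp ?_ (Or.imp ?_ ?_)
      · rintro ⟨h, e⟩
        refine ⟨h, ?_, by rw [e]⟩
        rw [e, norm_smul, Real.norm_of_nonneg (by norm_num)]
      · rintro ⟨h, e⟩
        refine ⟨h, ?_, by rw [e]⟩
        rw [e]
        exact norm_smul_div_norm zero_le_one (by linarith [h.1])
      · rintro ⟨h, e⟩
        refine ⟨h, ?_, by rw [e]⟩
        rw [e]
        exact norm_smul_div_norm (by linarith) (by linarith)
    rcases key hy with ⟨k1, k2, k3⟩ | ⟨⟨k0, k1⟩, k2, k3⟩ | ⟨k1, k2, k3⟩ <;>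
    rcases key hy' with ⟨l1, l2, l3⟩ | ⟨⟨l0, l1⟩, l2, l3⟩ | ⟨l1, l2, l3⟩ <;>
    rw [k2, l2] at h1 <;> rw [k3, l3] at h2 <;> linarith
  rcases hy.lt_or_eq with hlt | heq
  · left
    have h1 : (cylinderCollapse y).1 = (cylinderCollapse y').1 := by rw [h]
    unfold cylinderCollapse at h1
    rw [← hn] at h1
    refine smul_right_injective E (ne_of_gt (div_pos (lt_min one_pos (by linarith)) ?_)) h1
    exact lt_of_lt_of_le (by norm_num) (le_max_right _ _)
  · exact Or.inr ⟨heq, hn ▸ heq⟩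

/-- Each radial formula is inverted: radius `(2 - τ) / 3` on the side, `1 - ‖v‖ / 3` on the bottom,
`‖v‖ / 3` on the top. The center of the bottom comes from a unit vector, whence nontriviality. -/
theorem exists_cylinderCollapse_eq [Nontrivial E] {x : E × ℝ} (hx : x ∈ cylinderBoundary E) :
    ∃ y : E, ‖y‖ ≤ 1 ∧ cylinderCollapse y = x := by
  obtain ⟨v, τ⟩ := x
  obtain ⟨hv, hτ, h⟩ := hx
  change ‖v‖ ≤ 1 at hv
  change τ ∈ I at hτ
  change ‖v‖ = 1 ∨ τ = 0 ∨ τ = 1 at h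
  have hτ0 := hτ.1
  have hτ1 := hτ.2
  rcases h with h | rfl | rfl
  · have hn : ‖((2 - τ) / 3) • v‖ = (2 - τ) / 3 := by
      rw [norm_smul, h, Real.norm_of_nonneg (by linarith), mul_one]
    refine ⟨((2 - τ) / 3) • v, by linarith, ?_⟩
    unfold cylinderCollapse
    rw [hn, min_eq_left (by linarith), max_eq_left (by linarith), min_eq_right (by linarith),
      max_eq_right (by linarith), smul_smul, one_div_mul_cancel (by linarith), one_smul]
    exact Prod.ext rfl (by change 2 - 3 * ((2 - τ) / 3) = τ; ring)
  · rcases eq_or_ne v 0 with rfl | hv0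
    · obtain ⟨y, hy⟩ := exists_norm_eq E zero_le_one
      exact ⟨y, hy.le, cylinderCollapse_of_norm_eq_one hy⟩
    · have hp : 0 < ‖v‖ := norm_pos_iff.2 hv0
      have hn := norm_smul_div_norm (c := 1 - ‖v‖ / 3) (by linarith) hp
      refine ⟨((1 - ‖v‖ / 3) / ‖v‖) • v, by linarith, ?_⟩
      unfold cylinderCollapse
      rw [hn, min_eq_right (by linarith), max_eq_left (by linarith), min_eq_right (by linarith),
        max_eq_left (by linarith), smul_smul]
      refine Prod.ext ?_ rfl
      change _ • v = v
      have h3 : 1 - ‖v‖ / 3 ≠ 0 := by linarith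
      convert one_smul ℝ v
      have h4 : (3 - ‖v‖) ≠ 0 := by linarith
      field_simp
      ring
  · have hn : ‖(1 / 3 : ℝ) • v‖ = ‖v‖ / 3 := by
      rw [norm_smul, Real.norm_of_nonneg (by norm_num)]; ring
    refine ⟨(1 / 3 : ℝ) • v, by linarith, ?_⟩
    unfold cylinderCollapse
    rw [hn, min_eq_left (by linarith), max_eq_right (by linarith), min_eq_left (by linarith),
      max_eq_right (by linarith), smul_smul]
    norm_num

/-- The cone on `cylinderCollapse`: it maps the cylinder over the closed unit ball onto itself. -/
noncomputable def cylinderCone (x : E × ℝ) : E × ℝ :=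
  (x.2 • (cylinderCollapse x.1).1, 1 / 2 + x.2 * ((cylinderCollapse x.1).2 - 1 / 2))

theorem continuous_cylinderCone : Continuous (cylinderCone : E × ℝ → E × ℝ) := by
  have := continuous_cylinderCollapse (E := E)
  have h : Continuous fun x : E × ℝ => cylinderCollapse x.1 := this.comp continuous_fst
  exact (continuous_snd.smul h.fst).prodMk
    (continuous_const.add (continuous_snd.mul (h.snd.sub continuous_const)))

theorem cylinderCone_one (y : E) : cylinderCone (y, 1) = cylinderCollapse y := by
  refine Prod.ext ?_ ?_ <;> simp [cylinderCone]

omit [NormedSpace ℝ E] in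
-- The maximum is the gauge of the cylinder about its center `(0, 1/2)`. It recovers the radial
-- parameter of `cylinderCone`.
theorem max_of_mem_cylinderBoundary {x : E × ℝ} (hx : x ∈ cylinderBoundary E) :
    max ‖x.1‖ (2 * |x.2 - 1 / 2|) = 1 := by
  obtain ⟨h1, h2, h3⟩ := hx
  have h0 := h2.1
  have h2' := h2.2
  have : 2 * |x.2 - 1 / 2| ≤ 1 := by
    have : |x.2 - 1 / 2| ≤ 1 / 2 := abs_le.2 ⟨by linarith, by linarith⟩
    linarith
  rcases h3 with h | h | h
  · rw [h, max_eq_left this]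
  · rw [h, max_eq_right] <;> norm_num
    exact h1
  · rw [h, max_eq_right] <;> norm_num
    exact h1

theorem cylinderCone_mem {y : E} (hy : ‖y‖ ≤ 1) {s : ℝ} (hs : s ∈ I) :
    ‖(cylinderCone (y, s)).1‖ ≤ 1 ∧ (cylinderCone (y, s)).2 ∈ I := by
  obtain ⟨h1, h2, -⟩ := cylinderCollapse_mem hy
  have hs0 := hs.1
  have hs1 := hs.2
  constructor
  · change ‖s • _‖ ≤ 1
    rw [norm_smul, Real.norm_of_nonneg hs0]
    exact mul_le_one₀ hs1 (norm_nonneg _) h1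
  · have := (convex_Icc (0 : ℝ) 1) (show (1 / 2 : ℝ) ∈ Set.Icc 0 1 by constructor <;> norm_num) h2
      (show 0 ≤ 1 - s by linarith) hs0 (by ring)
    convert this using 1
    simp only [cylinderCone, smul_eq_mul]
    ring

theorem cylinderCone_eq_iff {y y' : E} (hy : ‖y‖ ≤ 1) (hy' : ‖y'‖ ≤ 1) {s s' : ℝ}
    (hs : 0 ≤ s) (hs' : 0 ≤ s') (h : cylinderCone (y, s) = cylinderCone (y', s')) :
    s = s' ∧ (s = 0 ∨ y = y' ∨ (‖y‖ = 1 ∧ ‖y'‖ = 1)) := by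
  have hmax : ∀ {y : E}, ‖y‖ ≤ 1 → ∀ {s : ℝ}, 0 ≤ s →
      max ‖(cylinderCone (y, s)).1‖ (2 * |(cylinderCone (y, s)).2 - 1 / 2|) = s := by
    intro y hy s hs
    have := max_of_mem_cylinderBoundary (cylinderCollapse_mem hy)
    simp only [cylinderCone, add_sub_cancel_left, norm_smul, abs_mul, Real.norm_of_nonneg hs,
      abs_of_nonneg hs]
    rw [mul_left_comm, ← mul_max_of_nonneg _ _ hs, this, mul_one]
  have hss : s = s' := by rw [← hmax hy hs, h, hmax hy' hs']
  subst hss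
  refine ⟨rfl, ?_⟩
  rcases eq_or_ne s 0 with h0 | h0
  · exact Or.inl h0
  · refine Or.inr (cylinderCollapse_eq_iff hy hy' ?_)
    have h1 : s • (cylinderCollapse y).1 = s • (cylinderCollapse y').1 := congrArg Prod.fst h
    have h2 : 1 / 2 + s * ((cylinderCollapse y).2 - 1 / 2) =
      1 / 2 + s * ((cylinderCollapse y').2 - 1 / 2) := congrArg Prod.snd h
    refine Prod.ext (smul_right_injective E h0 h1) ?_
    have := mul_left_cancel₀ h0 (add_left_cancel h2)
    linarith

theorem exists_cylinderCone_eq [Nontrivial E] {v : E} (hv : ‖v‖ ≤ 1) {τ : ℝ} (hτ : τ ∈ I) :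
    ∃ y : E, ‖y‖ ≤ 1 ∧ ∃ s ∈ I, cylinderCone (y, s) = (v, τ) := by
  set s := max ‖v‖ (2 * |τ - 1 / 2|) with hs
  have ha : 2 * |τ - 1 / 2| ≤ 1 := by
    have : |τ - 1 / 2| ≤ 1 / 2 := abs_le.2 ⟨by linarith [hτ.1], by linarith [hτ.2]⟩
    linarith
  have hs0 : 0 ≤ s := (norm_nonneg v).trans (le_max_left _ _)
  have hs1 : s ≤ 1 := max_le hv ha
  rcases hs0.eq_or_lt with h0 | h0
  · have hv0 : v = 0 := norm_le_zero_iff.1 (h0 ▸ le_max_left _ _)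
    have ht0 : τ - 1 / 2 = 0 := by
      have : 2 * |τ - 1 / 2| ≤ 0 := h0 ▸ le_max_right _ _
      exact abs_nonpos_iff.1 (by linarith)
    refine ⟨0, by simp, 0, ⟨le_rfl, zero_le_one⟩, Prod.ext ?_ ?_⟩
    · simp [cylinderCone, hv0]
    · simp only [cylinderCone]
      linarith
  · have hmem : ((1 / s) • v, 1 / 2 + (τ - 1 / 2) / s) ∈ cylinderBoundary E := by
      have hn : ‖(1 / s) • v‖ = ‖v‖ / s := by
        rw [norm_smul, Real.norm_of_nonneg (by positivity)]; ring
      have hb : |(τ - 1 / 2) / s| ≤ 1 / 2 := by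
        rw [abs_div, abs_of_pos h0, div_le_iff₀ h0]
        linarith [le_max_right ‖v‖ (2 * |τ - 1 / 2|)]
      rw [abs_le] at hb
      refine ⟨?_, ⟨by linarith [hb.1], by linarith [hb.2]⟩, ?_⟩
      · change ‖(1 / s) • v‖ ≤ 1
        rw [hn]
        exact div_le_one_of_le₀ (le_max_left _ _) hs0
      · change ‖(1 / s) • v‖ = 1 ∨ 1 / 2 + (τ - 1 / 2) / s = 0 ∨ 1 / 2 + (τ - 1 / 2) / s = 1
        rcases max_choice ‖v‖ (2 * |τ - 1 / 2|) with h | h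
        · left
          rw [hn, ← h, ← hs, div_self h0.ne']
        · right
          have hs' : s = 2 * |τ - 1 / 2| := hs.trans h
          rcases abs_choice (τ - 1 / 2) with h' | h' <;> rw [h'] at hs'
          · right
            have : τ - 1 / 2 = s * (1 / 2) := by linarith
            rw [this, mul_div_cancel_left₀ _ h0.ne']
            norm_num
          · left
            have : τ - 1 / 2 = s * (-1 / 2) := by linarith
            rw [this, mul_div_cancel_left₀ _ h0.ne']
            norm_num
    obtain ⟨y, hy, e⟩ := exists_cylinderCollapse_eq hmem
    refine ⟨y, hy, s, ⟨hs0, hs1⟩, ?_⟩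
    unfold cylinderCone
    rw [e]
    refine Prod.ext ?_ ?_
    · change s • (1 / s) • v = v
      rw [smul_smul, mul_one_div_cancel h0.ne', one_smul]
    · change 1 / 2 + s * (1 / 2 + (τ - 1 / 2) / s - 1 / 2) = τ
      field_simp
      ring

/-- A map on the boundary of the cylinder over a closed ball extends to the cylinder as soon as its
composition with `cylinderCollapse` can be deformed to a constant map through maps that are constant
on the unit sphere. -/
theorem exists_extension_cylinder [ProperSpace E] [Nontrivial E] {X : Type*} [TopologicalSpace X]
    (u : E × ℝ → X) (H : C(I × closedBall (0 : E) 1, X))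
    (h0 : ∀ y, H (0, y) = u (cylinderCollapse y)) (h1 : ∀ y y', H (1, y) = H (1, y'))
    (hH : ∀ s (y y' : closedBall (0 : E) 1), ‖(y : E)‖ = 1 → ‖(y' : E)‖ = 1 →
      H (s, y) = H (s, y')) :
    ∃ U : C(closedBall (0 : E) 1 × I, X), ∀ (v : closedBall (0 : E) 1) (t : I), ((v : E), (t : ℝ)) ∈ cylinderBoundary E →
      U (v, t) = u ((v : E), (t : ℝ)) := by
  have hb : ∀ y : closedBall (0 : E) 1, ‖(y : E)‖ ≤ 1 := fun y => mem_closedBall_zero_iff.1 y.2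
  -- Time is reversed: time 0 of `H` sits on the boundary, and time 1, where `H` is constant, at the
  -- apex.
  let Q : C(I × closedBall (0 : E) 1, closedBall (0 : E) 1 × I) :=
    { toFun := fun x => (⟨(cylinderCone ((x.2 : E), ((σ x.1 : I) : ℝ))).1,
          mem_closedBall_zero_iff.2 (cylinderCone_mem (hb x.2) (σ x.1).2).1⟩,
        ⟨(cylinderCone ((x.2 : E), ((σ x.1 : I) : ℝ))).2,
          (cylinderCone_mem (hb x.2) (σ x.1).2).2⟩)
      continuous_toFun := by
        have h : Continuous fun x : I × closedBall (0 : E) 1 =>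
            cylinderCone ((x.2 : E), ((σ x.1 : I) : ℝ)) :=
          continuous_cylinderCone.comp (by fun_prop)
        exact (h.fst.subtype_mk _).prodMk (h.snd.subtype_mk _) }
  have hQ' : ∀ x, (((Q x).1 : E), ((Q x).2 : ℝ)) = cylinderCone ((x.2 : E), ((σ x.1 : I) : ℝ)) :=
    fun x => rfl
  have : CompactSpace (closedBall (0 : E) 1) := isCompact_iff_compactSpace.1
    (isCompact_closedBall _ _)
  have hQ : Topology.IsQuotientMap Q := by
    refine Q.continuous.isClosedMap.isQuotientMap Q.continuous ?_
    rintro ⟨v, t⟩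
    obtain ⟨y, hy, s, hs, e⟩ := exists_cylinderCone_eq (hb v) t.2
    refine ⟨(σ ⟨s, hs⟩, ⟨y, mem_closedBall_zero_iff.2 hy⟩), ?_⟩
    have := hQ' (σ ⟨s, hs⟩, ⟨y, mem_closedBall_zero_iff.2 hy⟩)
    rw [unitInterval.symm_symm] at this
    rw [show cylinderCone (y, s) = _ from e] at this
    exact Prod.ext (Subtype.ext (congrArg Prod.fst this)) (Subtype.ext (congrArg Prod.snd this))
  have hfac : Function.FactorsThrough H Q := by
    rintro ⟨s, y⟩ ⟨s', y'⟩ h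
    have h' := (hQ' (s, y)).symm.trans ((by rw [h]) : _ = _) |>.trans (hQ' (s', y'))
    obtain ⟨e, hor⟩ := cylinderCone_eq_iff (hb y) (hb y') (σ s).2.1 (σ s').2.1 h'
    have hs : s = s' := unitInterval.symm_bijective.injective (Subtype.ext e)
    subst hs
    rcases hor with h0 | h0 | ⟨h0, h0'⟩
    · have : s = 1 := unitInterval.symm_bijective.injective
        (Subtype.ext (h0.trans (by simp)))
      rw [this]
      exact h1 _ _
    · rw [Subtype.ext h0]
    · exact hH _ _ _ h0 h0'
  refine ⟨hQ.lift H hfac, fun v t hvt => ?_⟩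
  obtain ⟨y, hy, e⟩ := exists_cylinderCollapse_eq hvt
  have h2 := hQ' (0, ⟨y, mem_closedBall_zero_iff.2 hy⟩)
  have h4 : cylinderCone (y, ((σ (0 : I) : I) : ℝ)) = (↑v, ↑t) := by
    rw [unitInterval.symm_zero, Set.Icc.coe_one, cylinderCone_one, e]
  replace h2 := h2.trans h4
  have h3 : Q (0, ⟨y, mem_closedBall_zero_iff.2 hy⟩) = (v, t) :=
    Prod.ext (Subtype.ext (congrArg Prod.fst h2)) (Subtype.ext (congrArg Prod.snd h2))
  rw [← h3, show hQ.lift H hfac (Q _) = H _ from DFunLike.congr_fun (hQ.lift_comp H hfac) _,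
    h0, e]

end Collapse

/-! ### Vanishing homotopy groups and fillings of cylinders -/

section Sphere

variable {X : Type*} [TopologicalSpace X]

theorem norm_two_mul_sub_one {n : ℕ} (y : Fin n → I) :
    ‖(fun i => 2 * (y i : ℝ) - 1)‖ ≤ 1 :=
  (pi_norm_le_iff_of_nonneg zero_le_one).2 fun i =>
    abs_le.2 ⟨by linarith [(y i).2.1], by linarith [(y i).2.2]⟩

theorem norm_two_mul_sub_one_eq_one {n : ℕ} {y : Fin n → I} (hy : y ∈ Cube.boundary (Fin n)) :
    ‖(fun i => 2 * (y i : ℝ) - 1)‖ = 1 := by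
  refine le_antisymm (norm_two_mul_sub_one y) ?_
  obtain ⟨i, hi⟩ := hy
  refine le_trans ?_ (norm_le_pi_norm (fun i => 2 * (y i : ℝ) - 1) i)
  rcases hi with hi | hi <;> rw [hi] <;> norm_num

/-- The affine homeomorphism from the closed unit ball of the sup norm to the unit cube. -/
noncomputable def ballToCube (n : ℕ) : C(closedBall (0 : Fin n → ℝ) 1, Fin n → I) where
  toFun y i := ⟨((y : Fin n → ℝ) i + 1) / 2, by
    have := abs_le.1 ((norm_le_pi_norm (y : Fin n → ℝ) i).trans (mem_closedBall_zero_iff.1 y.2))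
    constructor <;> linarith [this.1, this.2]⟩
  continuous_toFun := continuous_pi fun i => Continuous.subtype_mk
    ((((continuous_apply i).comp continuous_subtype_val).add continuous_const).div_const 2) _

theorem ballToCube_mem_boundary {n : ℕ} {y : closedBall (0 : Fin n → ℝ) 1}
    (hy : ‖(y : Fin n → ℝ)‖ = 1) : ballToCube n y ∈ Cube.boundary (Fin n) := by
  by_contra hcon
  refine absurd hy (ne_of_lt ((pi_norm_lt_iff one_pos).2 fun i => ?_))
  have h := abs_le.1 ((norm_le_pi_norm (y : Fin n → ℝ) i).trans (mem_closedBall_zero_iff.1 y.2))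
  refine abs_lt.2 ⟨lt_of_le_of_ne h.1 fun e => hcon ⟨i, Or.inl (Subtype.ext ?_)⟩,
    lt_of_le_of_ne h.2 fun e => hcon ⟨i, Or.inr (Subtype.ext ?_)⟩⟩
  · change ((y : Fin n → ℝ) i + 1) / 2 = 0
    rw [← e]; norm_num
  · change ((y : Fin n → ℝ) i + 1) / 2 = 1
    rw [e]; norm_num

theorem two_mul_ballToCube_sub_one {n : ℕ} (y : closedBall (0 : Fin n → ℝ) 1) :
    (fun i => 2 * (ballToCube n y i : ℝ) - 1) = (y : Fin n → ℝ) := by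
  ext i
  change 2 * (((y : Fin n → ℝ) i + 1) / 2) - 1 = _
  ring

/-- A map on the closed unit ball that is constant on the unit sphere extends to the whole space, by
a path in the radial direction. -/
theorem exists_radial_extension {E : Type*} [NormedAddCommGroup E] {x x₀ : X} (γ : Path x x₀)
    (p : C(closedBall (0 : E) 1, X)) (hp : ∀ y : closedBall (0 : E) 1, ‖(y : E)‖ = 1 → p y = x) :
    ∃ P : C(E, X), (∀ y : closedBall (0 : E) 1, P y = p y) ∧
      ∀ y, 1 ≤ ‖y‖ → P y = γ.extend (‖y‖ - 1) := by
  classical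
  let P : E → X := fun y => if h : ‖y‖ ≤ 1 then p ⟨y, mem_closedBall_zero_iff.2 h⟩
    else γ.extend (‖y‖ - 1)
  have h1 : ∀ y : closedBall (0 : E) 1, P y = p y := fun y =>
    dif_pos (mem_closedBall_zero_iff.1 y.2)
  have h2 : ∀ y, 1 ≤ ‖y‖ → P y = γ.extend (‖y‖ - 1) := by
    intro y hy
    by_cases h : ‖y‖ ≤ 1
    · have h' : ‖y‖ = 1 := le_antisymm h hy
      refine (dif_pos h).trans ((hp _ h').trans ?_)
      rw [h', sub_self, γ.extend_zero]
    · exact dif_neg h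
  have hc : Continuous P := by
    rw [← continuousOn_univ]
    have hU : (Set.univ : Set E) = closedBall 0 1 ∪ {y | 1 ≤ ‖y‖} := by
      ext y
      simpa using le_total ‖y‖ 1
    rw [hU]
    refine ContinuousOn.union_of_isClosed ?_ ?_ isClosed_closedBall
      (isClosed_le continuous_const continuous_norm)
    · rw [continuousOn_iff_continuous_domRestrict]
      exact p.continuous.congr fun y => (h1 y).symm
    · refine ContinuousOn.congr (f := fun y => γ.extend (‖y‖ - 1)) ?_ h2
      exact (γ.continuous_extend.comp (continuous_norm.sub continuous_const)).continuousOn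
  exact ⟨⟨P, hc⟩, h1, h2⟩

/-- If `π_n(X, x₀)` is trivial and `X` is path-connected, then every map from the closed `n`-ball
that is constant on the unit sphere can be deformed to a constant map through such maps. -/
theorem exists_homotopy_const [PathConnectedSpace X] {n : ℕ} {x₀ : X}
    (hπ : Subsingleton (HomotopyGroup.Pi n X x₀)) (p : C(closedBall (0 : Fin n → ℝ) 1, X)) {x : X}
    (hp : ∀ y : closedBall (0 : Fin n → ℝ) 1, ‖(y : Fin n → ℝ)‖ = 1 → p y = x) :
    ∃ H : p.Homotopy (ContinuousMap.const _ x₀),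
      ∀ s (y y' : closedBall (0 : Fin n → ℝ) 1), ‖(y : Fin n → ℝ)‖ = 1 → ‖(y' : Fin n → ℝ)‖ = 1 → H (s, y) = H (s, y') := by
  obtain ⟨P, hP1, hP2⟩ := exists_radial_extension (PathConnectedSpace.somePath x x₀) p hp
  set γ := PathConnectedSpace.somePath x x₀
  -- The cube is scaled onto the sup-norm ball of radius 2, whose boundary is where the radial path
  -- has reached `x₀`.
  let w : C(Fin n → I, X) :=
    { toFun := fun y => P ((2 : ℝ) • fun i => 2 * (y i : ℝ) - 1)
      continuous_toFun := by fun_prop }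
  have hw : ∀ y ∈ Cube.boundary (Fin n), w y = x₀ := by
    intro y hy
    have hn : ‖(2 : ℝ) • fun i => 2 * (y i : ℝ) - 1‖ = 2 := by
      rw [norm_smul, norm_two_mul_sub_one_eq_one hy]; norm_num
    refine (hP2 _ (by rw [hn]; norm_num)).trans ?_
    rw [hn, show (2 : ℝ) - 1 = 1 by norm_num, γ.extend_one]
  obtain ⟨K⟩ : GenLoop.Homotopic (⟨w, hw⟩ : GenLoop (Fin n) X x₀) GenLoop.const :=
    Quotient.exact (hπ.elim (Quotient.mk _ _) (Quotient.mk _ _))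
  -- Dilation from radius 1 to radius 2; every point of the unit sphere traces the same path `γ`.
  let F₁ : p.Homotopy (w.comp (ballToCube n)) :=
    { toFun := fun z => P ((1 + (z.1 : ℝ)) • (z.2 : Fin n → ℝ))
      continuous_toFun := by fun_prop
      map_zero_left := fun y => by
        simp only [Set.Icc.coe_zero, add_zero, one_smul]
        exact hP1 y
      map_one_left := fun y => by
        change _ = P ((2 : ℝ) • fun i => 2 * (ballToCube n y i : ℝ) - 1)
        rw [two_mul_ballToCube_sub_one, Set.Icc.coe_one, one_add_one_eq_two] }
  let F₂ : (w.comp (ballToCube n)).Homotopy (ContinuousMap.const _ x₀) :=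
    { toFun := fun z => K (z.1, ballToCube n z.2)
      continuous_toFun := by fun_prop
      map_zero_left := fun y => K.apply_zero _
      map_one_left := fun y => K.apply_one _ }
  have hF₁ : ∀ (s : I) (y : closedBall (0 : Fin n → ℝ) 1), ‖(y : Fin n → ℝ)‖ = 1 →
      F₁ (s, y) = γ.extend s := by
    intro s y hy
    have hn : ‖(1 + (s : ℝ)) • (y : Fin n → ℝ)‖ = 1 + s := by
      rw [norm_smul, hy, Real.norm_of_nonneg (by linarith [s.2.1]), mul_one]
    refine (hP2 _ (by rw [hn]; linarith [s.2.1])).trans ?_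
    rw [hn, add_sub_cancel_left]
  have hF₂ : ∀ (s : I) (y : closedBall (0 : Fin n → ℝ) 1), ‖(y : Fin n → ℝ)‖ = 1 →
      F₂ (s, y) = x₀ := fun s y hy =>
    (K.eq_fst s (ballToCube_mem_boundary hy)).trans (hw _ (ballToCube_mem_boundary hy))
  refine ⟨F₁.trans F₂, fun s y y' hy hy' => ?_⟩
  simp only [ContinuousMap.Homotopy.trans_apply]
  split_ifs with h
  · rw [hF₁ _ _ hy, hF₁ _ _ hy']
  · rw [hF₂ _ _ hy, hF₂ _ _ hy']

/-- Precomposed with `cylinderCollapse`, the boundary data become a map of the `n`-ball that is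
constant on the unit sphere. Its deformation to a constant fills the cylinder, seen as a cone. -/
theorem exists_filler_of_pi [PathConnectedSpace X] {n : ℕ} {x₀ : X} (hn : n ≠ 0)
    (hπ : Subsingleton (HomotopyGroup.Pi n X x₀)) (u : (Fin n → ℝ) × ℝ → X)
    (hu : ContinuousOn u (cylinderBoundary (Fin n → ℝ))) :
    ∃ U : C(closedBall (0 : Fin n → ℝ) 1 × I, X), ∀ (v : closedBall (0 : Fin n → ℝ) 1) (t : I),
      ((v : Fin n → ℝ), (t : ℝ)) ∈ cylinderBoundary (Fin n → ℝ) →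
        U (v, t) = u ((v : Fin n → ℝ), (t : ℝ)) := by
  have : NeZero n := ⟨hn⟩
  let p : C(closedBall (0 : Fin n → ℝ) 1, X) :=
    { toFun := fun y => u (cylinderCollapse (y : Fin n → ℝ))
      continuous_toFun := hu.comp_continuous
        (continuous_cylinderCollapse.comp continuous_subtype_val)
        fun y => cylinderCollapse_mem (mem_closedBall_zero_iff.1 y.2) }
  obtain ⟨H, hH⟩ := exists_homotopy_const hπ p (x := u (0, 0))
    fun y hy => congrArg u (cylinderCollapse_of_norm_eq_one hy)
  refine exists_extension_cylinder u H.toContinuousMap (fun y => H.apply_zero y)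
    (fun y y' => (H.apply_one y).trans (H.apply_one y').symm) hH

end Sphere

/-! ### Building maps out of a CW complex cell by cell -/

section Cells

open Topology Topology.CWComplex

variable {Y Z : Type*} [TopologicalSpace Y] [TopologicalSpace Z] [T2Space Y]
  [CWComplex (Set.univ : Set Y)]

/-- By compactness of the ball, the characteristic map sends closed subsets of it to closed sets, so
continuity can be tested upstairs. -/
theorem continuousOn_closedCell_of_comp {h : Y → Z} {n : ℕ} {i : cell (Set.univ : Set Y) n}
    (hh : ContinuousOn (h ∘ map n i) (closedBall 0 1)) :
    ContinuousOn h (closedCell n i) := by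
  rw [continuousOn_iff_isClosed]
  intro t ht
  obtain ⟨u, hu, e⟩ := continuousOn_iff_isClosed.1 hh t ht
  refine ⟨map n i '' (u ∩ closedBall 0 1), ?_, ?_⟩
  · exact (((isCompact_closedBall _ _).inter_left hu).image_of_continuousOn
      ((continuousOn n i).mono Set.inter_subset_right)).isClosed
  · rw [← e]
    ext y
    constructor
    · rintro ⟨hy, x, hx, rfl⟩
      exact ⟨⟨x, ⟨hy, hx⟩, rfl⟩, x, hx, rfl⟩
    · rintro ⟨⟨x, ⟨hx, hx'⟩, rfl⟩, -⟩
      exact ⟨hx, x, hx', rfl⟩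

theorem continuous_of_continuousOn_closedCell {h : Y → Z}
    (hh : ∀ n (i : cell (Set.univ : Set Y) n), ContinuousOn h (closedCell n i)) :
    Continuous h := by
  rw [continuous_iff_isClosed]
  intro t ht
  rw [CWComplex.closed (Set.univ : Set Y) _ (Set.subset_univ _)]
  intro n i
  obtain ⟨u, hu, e⟩ := continuousOn_iff_isClosed.1 (hh n i) t ht
  rw [e]
  exact hu.inter isClosed_closedCell

/-- Closure finiteness: the frontier is covered by finitely many closed cells of lower dimension. -/
theorem continuousOn_cellFrontier {h : Y → Z} {n : ℕ}
    (hh : ∀ m < n, ∀ j : cell (Set.univ : Set Y) m, ContinuousOn h (closedCell m j))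
    (i : cell (Set.univ : Set Y) n) : ContinuousOn h (cellFrontier n i) := by
  obtain ⟨J, hJ⟩ := cellFrontier_subset_finite_closedCell n i
  let T : Set (Σ m, cell (Set.univ : Set Y) m) := ⋃ m ∈ Set.Iio n, Sigma.mk m '' (J m : Set _)
  have hT : T.Finite := (Set.finite_Iio n).biUnion fun m _ => (J m).finite_toSet.image _
  have : Finite T := hT
  refine ContinuousOn.mono (s := ⋃ c : T, closedCell c.1.1 c.1.2) ?_ ?_
  · refine (locallyFinite_of_finite _).continuousOn_iUnion (fun _ => isClosed_closedCell) ?_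
    rintro ⟨⟨m, j⟩, hc⟩
    simp only [T, Set.mem_iUnion, Set.mem_image] at hc
    obtain ⟨m', hm', j', hj', e⟩ := hc
    cases e
    exact hh m hm' j
  · refine hJ.trans ?_
    intro y hy
    simp only [Set.mem_iUnion] at hy ⊢
    obtain ⟨m, hm, j, hj, hy⟩ := hy
    refine ⟨⟨⟨m, j⟩, ?_⟩, hy⟩
    simp only [T, Set.mem_iUnion, Set.mem_image]
    exact ⟨m, hm, j, hj, rfl⟩

omit [T2Space Y] in
theorem exists_mem_openCell (y : Y) :
    ∃ (c : Σ n, cell (Set.univ : Set Y) n), y ∈ openCell c.1 c.2 := by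
  have h := CWComplex.iUnion_openCell_eq_complex (C := (Set.univ : Set Y))
  have hy : y ∈ ⋃ (n : ℕ) (j : cell (Set.univ : Set Y) n), openCell n j := by
    rw [h]; trivial
  simp only [Set.mem_iUnion] at hy
  obtain ⟨n, j, hj⟩ := hy
  exact ⟨⟨n, j⟩, hj⟩

omit [T2Space Y] in
theorem mem_openCell_unique {y : Y} {c c' : Σ n, cell (Set.univ : Set Y) n}
    (h : y ∈ openCell c.1 c.2) (h' : y ∈ openCell c'.1 c'.2) : c = c' := by
  by_contra hne
  exact Set.disjoint_left.1 (disjoint_openCell_of_ne hne) h h'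

/-- The cell whose interior contains a given point. -/
noncomputable def carrier (y : Y) : Σ n, cell (Set.univ : Set Y) n :=
  (exists_mem_openCell y).choose

omit [T2Space Y] in
theorem mem_carrier (y : Y) : y ∈ openCell (carrier y).1 (carrier y).2 :=
  (exists_mem_openCell y).choose_spec

theorem carrier_fst_lt {n : ℕ} {i : cell (Set.univ : Set Y) n} {y : Y}
    (hy : y ∈ cellFrontier n i) : (carrier y).1 < n := by
  have h := cellFrontier_subset_skeletonLT n i hy
  rw [← CWComplex.iUnion_openCell_eq_skeletonLT] at h
  simp only [Set.mem_iUnion] at h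
  obtain ⟨m, hm, j, hj⟩ := h
  rw [mem_openCell_unique (mem_carrier y) (c' := ⟨m, j⟩) hj]
  exact_mod_cast hm

/-- A relation between the points of a CW complex and those of a space has a continuous section if
partial sections on the boundary of a cell extend to the cell. -/
theorem exists_section_of_cells [Nonempty Z] (P : Y → Z → Prop)
    (hP : ∀ n (i : cell (Set.univ : Set Y) n) (k : (Fin n → ℝ) → Z),
      ContinuousOn k (sphere 0 1) → (∀ x ∈ sphere (0 : Fin n → ℝ) 1, P (map n i x) (k x)) →
      ∃ k' : (Fin n → ℝ) → Z, ContinuousOn k' (closedBall 0 1) ∧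
        (∀ x ∈ sphere (0 : Fin n → ℝ) 1, k' x = k x) ∧
        ∀ x ∈ closedBall (0 : Fin n → ℝ) 1, P (map n i x) (k' x)) :
    ∃ h : C(Y, Z), ∀ y, P y (h y) := by
  classical
  choose! ext hext1 hext2 hext3 using hP
  -- Recursion on the dimension of the carrier: extend over the cell the values already defined on
  -- its frontier. The default value is only used off the unit sphere, where the boundary data do
  -- not matter.
  let H : Y → Z := (measure fun y : Y => (carrier y).1).wf.fix fun y rec =>
    ext (carrier y).1 (carrier y).2 (fun x =>
      if hx : (carrier (map (carrier y).1 (carrier y).2 x)).1 < (carrier y).1 then rec _ hx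
      else Classical.arbitrary Z) ((map (carrier y).1 (carrier y).2).symm y)
  let k : (c : Σ n, cell (Set.univ : Set Y) n) → (Fin c.1 → ℝ) → Z := fun c x =>
    if (carrier (map c.1 c.2 x)).1 < c.1 then H (map c.1 c.2 x) else Classical.arbitrary Z
  have hH : ∀ y c, carrier y = c → H y = ext c.1 c.2 (k c) ((map c.1 c.2).symm y) := by
    rintro y _ rfl
    refine (WellFounded.fix_eq _ _ _).trans ?_
    congr 1
  have hsph : ∀ (c : Σ n, cell (Set.univ : Set Y) n), ∀ x ∈ sphere (0 : Fin c.1 → ℝ) 1,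
      k c x = H (map c.1 c.2 x) := fun c x hx =>
    if_pos (carrier_fst_lt (Set.mem_image_of_mem _ hx))
  have key : ∀ (n : ℕ) (i : cell (Set.univ : Set Y) n),
      ContinuousOn (H ∘ map n i) (closedBall 0 1) ∧
        ∀ x ∈ closedBall (0 : Fin n → ℝ) 1, P (map n i x) (H (map n i x)) := by
    intro n
    induction n using Nat.strong_induction_on with
    | _ n ih =>
      intro i
      have hk1 : ContinuousOn (k ⟨n, i⟩) (sphere 0 1) := by
        have h1 := continuousOn_cellFrontier
          (fun m hm j => continuousOn_closedCell_of_comp (ih m hm j).1) i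
        exact (h1.comp ((continuousOn n i).mono sphere_subset_closedBall)
          (Set.mapsTo_image _ _)).congr (hsph ⟨n, i⟩)
      have hk2 : ∀ x ∈ sphere (0 : Fin n → ℝ) 1, P (map n i x) (k ⟨n, i⟩ x) := by
        intro x hx
        rw [hsph ⟨n, i⟩ x hx]
        obtain ⟨J, hJ⟩ := cellFrontier_subset_finite_closedCell n i
        have hm := hJ (Set.mem_image_of_mem _ hx)
        simp only [Set.mem_iUnion] at hm
        obtain ⟨m, hm, j, -, x', hx', e⟩ := hm
        change P (map n i x) (H (map n i x))
        rw [← e]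
        exact (ih m hm j).2 x' hx'
      -- Inside the ball this is the recursion, because open cells are disjoint; on the sphere it is
      -- the extension property.
      have heq : ∀ x ∈ closedBall (0 : Fin n → ℝ) 1,
          H (map n i x) = ext n i (k ⟨n, i⟩) x := by
        intro x hx
        rcases (mem_closedBall.1 hx).lt_or_eq with hlt | he
        · have hb : x ∈ ball (0 : Fin n → ℝ) 1 := hlt
          rw [hH _ ⟨n, i⟩ (mem_openCell_unique (mem_carrier _) (Set.mem_image_of_mem _ hb)),
            (map n i).left_inv (by rwa [source_eq])]
        · rw [hext2 n i _ hk1 hk2 x he]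
          exact (hsph ⟨n, i⟩ x he).symm
      refine ⟨(hext1 n i _ hk1 hk2).congr heq, fun x hx => ?_⟩
      rw [heq x hx]
      exact hext3 n i _ hk1 hk2 x hx
  refine ⟨⟨H, continuous_of_continuousOn_closedCell fun n i =>
    continuousOn_closedCell_of_comp (key n i).1⟩, fun y => ?_⟩
  obtain ⟨x, hx, e⟩ := openCell_subset_closedCell _ _ (mem_carrier y)
  change P y (H y)
  rw [← e]
  exact (key _ _).2 x hx

end Cells

/-! ### Transporting a class of loops along paths -/

section Transport

open CategoryTheory

variable {X Y : Type*} [TopologicalSpace X] [TopologicalSpace Y]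

/-- The action of a continuous map on classes of paths. -/
def pushArrow (g : C(Y, X)) {y y' : Y} (q : FundamentalGroupoid.mk y ⟶ FundamentalGroupoid.mk y') :
    FundamentalGroupoid.mk (g y) ⟶ FundamentalGroupoid.mk (g y') :=
  Path.Homotopic.Quotient.map q g

theorem pushArrow_comp (g : C(Y, X)) {y y' y'' : Y}
    (q : FundamentalGroupoid.mk y ⟶ FundamentalGroupoid.mk y')
    (q' : FundamentalGroupoid.mk y' ⟶ FundamentalGroupoid.mk y'') :
    pushArrow g (q ≫ q') = pushArrow g q ≫ pushArrow g q' :=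
  (FundamentalGroupoid.map g).map_comp q q'

theorem pushArrow_id (g : C(Y, X)) (y : Y) :
    pushArrow g (𝟙 (FundamentalGroupoid.mk y)) = 𝟙 _ :=
  (FundamentalGroupoid.map g).map_id _

theorem pushArrow_inv (g : C(Y, X)) {y y' : Y}
    (q : FundamentalGroupoid.mk y ⟶ FundamentalGroupoid.mk y') :
    pushArrow g (inv q) = inv (pushArrow g q) :=
  (FundamentalGroupoid.map g).map_inv q

/-- The class of a map on the unit interval with equal endpoints. -/
def loopArrow {x : X} (z : C(I, X)) (h0 : z 0 = x) (h1 : z 1 = x) :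
    FundamentalGroupoid.mk x ⟶ FundamentalGroupoid.mk x :=
  Path.Homotopic.Quotient.mk ⟨z, h0, h1⟩

/-- With the two parameters exchanged, a family of loops at `g (p s)` is a self-homotopy of `g ∘ p`;
the equation is its naturality square along the unit interval. -/
theorem push_comp_loopArrow (g : C(Y, X)) (p : C(I, Y)) (k : C(I, C(I, X)))
    (h0 : ∀ s, k s 0 = g (p s)) (h1 : ∀ s, k s 1 = g (p s)) :
    pushArrow g (Path.Homotopic.Quotient.mk (⟨p, rfl, rfl⟩ : Path (p 0) (p 1))) ≫
        loopArrow (k 1) (h0 1) (h1 1) =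
      loopArrow (k 0) (h0 0) (h1 0) ≫
        pushArrow g (Path.Homotopic.Quotient.mk (⟨p, rfl, rfl⟩ : Path (p 0) (p 1))) := by
  let F : (g.comp p).Homotopy (g.comp p) :=
    { toFun := fun x => k x.2 x.1
      continuous_toFun := by fun_prop
      map_zero_left := h0
      map_one_left := h1 }
  exact Path.Homotopic.Quotient.eq.2
    (Path.Homotopic.map_trans_evalAt F (⟨ContinuousMap.id I, rfl, rfl⟩ : Path (0 : I) 1))

/-- `z` is a loop at `g y` that is conjugate to `d` along the image of every path from the base
point to `y`. -/
def IsTransported (g : C(Y, X)) {y₀ : Y}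
    (d : FundamentalGroupoid.mk (g y₀) ⟶ FundamentalGroupoid.mk (g y₀)) (y : Y) (z : C(I, X)) :
    Prop :=
  ∃ (h0 : z 0 = g y) (h1 : z 1 = g y),
    ∀ q : FundamentalGroupoid.mk y₀ ⟶ FundamentalGroupoid.mk y,
      d ≫ pushArrow g q = pushArrow g q ≫ loopArrow z h0 h1

variable {g : C(Y, X)} {y₀ : Y}
  {d : FundamentalGroupoid.mk (g y₀) ⟶ FundamentalGroupoid.mk (g y₀)}

/-- Two paths from `y₀` to `y` differ by a loop at `y₀`, whose image commutes with `d`. This is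
where the centralizer condition enters. -/
theorem comp_push_eq_of_exists (hd : ∀ l, d ≫ pushArrow g l = pushArrow g l ≫ d) {y : Y}
    {a : FundamentalGroupoid.mk (g y) ⟶ FundamentalGroupoid.mk (g y)}
    (q : FundamentalGroupoid.mk y₀ ⟶ FundamentalGroupoid.mk y)
    (hq : d ≫ pushArrow g q = pushArrow g q ≫ a)
    (q' : FundamentalGroupoid.mk y₀ ⟶ FundamentalGroupoid.mk y) :
    d ≫ pushArrow g q' = pushArrow g q' ≫ a := by
  have e : q' = (q' ≫ inv q) ≫ q := by simp
  rw [e, pushArrow_comp, ← Category.assoc, hd, Category.assoc, hq, Category.assoc]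

theorem exists_isTransported [PathConnectedSpace Y]
    (hd : ∀ l, d ≫ pushArrow g l = pushArrow g l ≫ d) (y : Y) :
    ∃ z : C(I, X), IsTransported g d y z := by
  let q : FundamentalGroupoid.mk y₀ ⟶ FundamentalGroupoid.mk y :=
    Path.Homotopic.Quotient.mk (PathConnectedSpace.somePath y₀ y)
  obtain ⟨z, hz⟩ := Path.Homotopic.Quotient.mk_surjective
    (inv (pushArrow g q) ≫ d ≫ pushArrow g q : FundamentalGroupoid.mk (g y) ⟶ .mk (g y))
  refine ⟨z.toContinuousMap, z.source, z.target, comp_push_eq_of_exists hd q ?_⟩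
  have : loopArrow z.toContinuousMap z.source z.target =
    inv (pushArrow g q) ≫ d ≫ pushArrow g q := hz
  rw [this]
  simp

/-- Along a continuous family of loops over a path, the right class at the start forces the right
class at the end. -/
theorem IsTransported.along (hd : ∀ l, d ≫ pushArrow g l = pushArrow g l ≫ d)
    [PathConnectedSpace Y] (p : C(I, Y)) (k : C(I, C(I, X)))
    (h0 : ∀ s, k s 0 = g (p s)) (h1 : ∀ s, k s 1 = g (p s)) (hk : IsTransported g d (p 0) (k 0)) :
    IsTransported g d (p 1) (k 1) := by
  obtain ⟨_, _, hk⟩ := hk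
  let q : FundamentalGroupoid.mk y₀ ⟶ FundamentalGroupoid.mk (p 0) :=
    Path.Homotopic.Quotient.mk (PathConnectedSpace.somePath y₀ (p 0))
  let r : FundamentalGroupoid.mk (p 0) ⟶ FundamentalGroupoid.mk (p 1) :=
    Path.Homotopic.Quotient.mk (⟨p, rfl, rfl⟩ : Path (p 0) (p 1))
  refine ⟨h0 1, h1 1, comp_push_eq_of_exists hd (q ≫ r) ?_⟩
  rw [pushArrow_comp, ← Category.assoc, hk q, Category.assoc, Category.assoc,
    push_comp_loopArrow g p k h0 h1]

end Transport

/-! ### Extending the choice of loops over a cell -/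

section Extension

open CategoryTheory

variable {X Y : Type*} [TopologicalSpace X] [TopologicalSpace Y] [PathConnectedSpace Y]
  {g : C(Y, X)} {y₀ : Y} {d : FundamentalGroupoid.mk (g y₀) ⟶ FundamentalGroupoid.mk (g y₀)}

/-- A filler need only have the right boundary values: a segment joins each point of the ball to the
unit sphere, nonempty as `n ≠ 0`, and transports the class inward. -/
theorem exists_extension_of_filler (hd : ∀ l, d ≫ pushArrow g l = pushArrow g l ≫ d) {n : ℕ}
    (hn : n ≠ 0) {φ : (Fin n → ℝ) → Y} (hφ : ContinuousOn φ (closedBall 0 1))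
    {k : (Fin n → ℝ) → C(I, X)} (hk : ∀ x ∈ sphere (0 : Fin n → ℝ) 1, IsTransported g d (φ x) (k x))
    (K : C(closedBall (0 : Fin n → ℝ) 1 × I, X)) (hK0 : ∀ v, K (v, 0) = g (φ v))
    (hK1 : ∀ v, K (v, 1) = g (φ v))
    (hK : ∀ (v : closedBall (0 : Fin n → ℝ) 1) t, ‖(v : Fin n → ℝ)‖ = 1 → K (v, t) = k v t) :
    ∃ k' : (Fin n → ℝ) → C(I, X), ContinuousOn k' (closedBall 0 1) ∧
      (∀ x ∈ sphere (0 : Fin n → ℝ) 1, k' x = k x) ∧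
      ∀ x ∈ closedBall (0 : Fin n → ℝ) 1, IsTransported g d (φ x) (k' x) := by
  classical
  have : NeZero n := ⟨hn⟩
  let k' : (Fin n → ℝ) → C(I, X) := fun x =>
    if h : x ∈ closedBall (0 : Fin n → ℝ) 1 then K.curry ⟨x, h⟩ else k x
  have e : ∀ x : closedBall (0 : Fin n → ℝ) 1, k' x = K.curry x := fun x => dif_pos x.2
  have hc : ContinuousOn k' (closedBall 0 1) := by
    rw [continuousOn_iff_continuous_domRestrict]
    exact K.curry.continuous.congr fun y => (e y).symm
  have hs : ∀ x ∈ sphere (0 : Fin n → ℝ) 1, k' x = k x := by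
    intro x hx
    ext t
    rw [e ⟨x, sphere_subset_closedBall hx⟩]
    exact hK _ t (mem_sphere_zero_iff_norm.1 hx)
  refine ⟨k', hc, hs, fun x hx => ?_⟩
  obtain ⟨v, hv⟩ := exists_norm_eq (Fin n → ℝ) zero_le_one
  have hvs : v ∈ sphere (0 : Fin n → ℝ) 1 := mem_sphere_zero_iff_norm.2 hv
  let L : I → Fin n → ℝ := fun s => AffineMap.lineMap v x (s : ℝ)
  have hLc : Continuous L := AffineMap.lineMap_continuous.comp continuous_subtype_val
  have hL : ∀ s, L s ∈ closedBall (0 : Fin n → ℝ) 1 := fun s =>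
    (convex_closedBall (0 : Fin n → ℝ) 1).lineMap_mem (sphere_subset_closedBall hvs) hx s.2
  have hL0 : L 0 = v := by simp [L]
  have hL1 : L 1 = x := by simp [L]
  have key := IsTransported.along hd (⟨φ ∘ L, hφ.comp_continuous hLc hL⟩ : C(I, Y))
    (⟨k' ∘ L, hc.comp_continuous hLc hL⟩ : C(I, C(I, X)))
    (fun s => (congrArg (fun z : C(I, X) => z 0) (e ⟨L s, hL s⟩)).trans (hK0 ⟨L s, hL s⟩))
    (fun s => (congrArg (fun z : C(I, X) => z 1) (e ⟨L s, hL s⟩)).trans (hK1 ⟨L s, hL s⟩))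
    (by
      change IsTransported g d (φ (L 0)) (k' (L 0))
      rw [hL0, hs v hvs]
      exact hk v hvs)
  change IsTransported g d (φ (L 1)) (k' (L 1)) at key
  rwa [hL1] at key

/-- No vanishing of `π₁` is available here. Instead, both end loops are conjugate to `d` along
compatible paths, hence to each other along the edge, so the boundary of the square commutes up to
homotopy. -/
theorem exists_filler_interval {φ : (Fin 1 → ℝ) → Y} (hφ : ContinuousOn φ (closedBall 0 1))
    {k : (Fin 1 → ℝ) → C(I, X)}
    (hk : ∀ x ∈ sphere (0 : Fin 1 → ℝ) 1, IsTransported g d (φ x) (k x)) :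
    ∃ K : C(closedBall (0 : Fin 1 → ℝ) 1 × I, X), (∀ v, K (v, 0) = g (φ v)) ∧
      (∀ v, K (v, 1) = g (φ v)) ∧
      ∀ (v : closedBall (0 : Fin 1 → ℝ) 1) t, ‖(v : Fin 1 → ℝ)‖ = 1 → K (v, t) = k v t := by
  let L : I → Fin 1 → ℝ := fun s _ => 2 * (s : ℝ) - 1
  have hL : ∀ s, L s ∈ closedBall (0 : Fin 1 → ℝ) 1 := fun s =>
    mem_closedBall_zero_iff.2 (norm_two_mul_sub_one fun _ => s)
  have hLc : Continuous L := by fun_prop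
  let p : C(I, Y) := ⟨φ ∘ L, hφ.comp_continuous hLc hL⟩
  have hs0 : L 0 ∈ sphere (0 : Fin 1 → ℝ) 1 := mem_sphere_zero_iff_norm.2
    (norm_two_mul_sub_one_eq_one (y := fun _ => 0) ⟨0, Or.inl rfl⟩)
  have hs1 : L 1 ∈ sphere (0 : Fin 1 → ℝ) 1 := mem_sphere_zero_iff_norm.2
    (norm_two_mul_sub_one_eq_one (y := fun _ => 1) ⟨0, Or.inr rfl⟩)
  obtain ⟨a0, a1, ha⟩ := hk _ hs0
  obtain ⟨b0, b1, hb⟩ := hk _ hs1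
  let a : Path (g (p 0)) (g (p 0)) := ⟨k (L 0), a0, a1⟩
  let b : Path (g (p 1)) (g (p 1)) := ⟨k (L 1), b0, b1⟩
  let r : Path (p 0) (p 1) := ⟨p, rfl, rfl⟩
  have hsq : ((r.map g.continuous).trans b).Homotopic (a.trans (r.map g.continuous)) := by
    let q : FundamentalGroupoid.mk y₀ ⟶ FundamentalGroupoid.mk (p 0) :=
      Path.Homotopic.Quotient.mk (PathConnectedSpace.somePath y₀ (p 0))
    let ρ : FundamentalGroupoid.mk (p 0) ⟶ FundamentalGroupoid.mk (p 1) :=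
      Path.Homotopic.Quotient.mk r
    have h1 := ha q
    have h2 := hb (q ≫ ρ)
    rw [pushArrow_comp, ← Category.assoc, h1, Category.assoc, Category.assoc] at h2
    exact Path.Homotopic.Quotient.eq.1 ((cancel_epi (pushArrow g q)).1 h2).symm
  obtain ⟨S, hS1, hS2, hS3, hS4⟩ := exists_square_filler hsq
  have hpt : ∀ v : closedBall (0 : Fin 1 → ℝ) 1, L (ballToCube 1 v 0) = v := fun v => by
    refine Eq.trans ?_ (two_mul_ballToCube_sub_one v)
    ext i
    rw [Subsingleton.elim i 0]
  have hp : ∀ v : closedBall (0 : Fin 1 → ℝ) 1, g (p (ballToCube 1 v 0)) = g (φ v) := fun v =>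
    congrArg (fun x => g (φ x)) (hpt v)
  refine ⟨⟨fun x => S (ballToCube 1 x.1 0, x.2), by fun_prop⟩, fun v => (hS1 _).trans (hp v),
    fun v => (hS4 _).trans (hp v), fun v t hv => ?_⟩
  obtain ⟨i, hi⟩ := ballToCube_mem_boundary hv
  rw [Subsingleton.elim i 0] at hi
  change S (ballToCube 1 v 0, t) = _
  rw [← hpt v]
  rcases hi with hi | hi <;> rw [hi]
  · exact hS3 t
  · exact hS2 t

omit [PathConnectedSpace Y] in
-- The loops `k x` on the side and `g ∘ φ` on the two ends agree where they meet, so they form a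
-- continuous map on the boundary of the cylinder. Only the base points of the loops matter.
theorem exists_filler_cell [PathConnectedSpace X] {n : ℕ} {x₀ : X} (hn : n ≠ 0)
    (hπ : Subsingleton (HomotopyGroup.Pi n X x₀)) {φ : (Fin n → ℝ) → Y}
    (hφ : ContinuousOn φ (closedBall 0 1)) {k : (Fin n → ℝ) → C(I, X)}
    (hkc : ContinuousOn k (sphere 0 1))
    (hk : ∀ x ∈ sphere (0 : Fin n → ℝ) 1, k x 0 = g (φ x) ∧ k x 1 = g (φ x)) :
    ∃ K : C(closedBall (0 : Fin n → ℝ) 1 × I, X), (∀ v, K (v, 0) = g (φ v)) ∧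
      (∀ v, K (v, 1) = g (φ v)) ∧
      ∀ (v : closedBall (0 : Fin n → ℝ) 1) t, ‖(v : Fin n → ℝ)‖ = 1 → K (v, t) = k v t := by
  classical
  let u : (Fin n → ℝ) × ℝ → X := fun x =>
    if ‖x.1‖ = 1 then k x.1 (Set.projIcc 0 1 zero_le_one x.2) else g (φ x.1)
  have hu1 : ∀ x : (Fin n → ℝ) × ℝ, ‖x.1‖ = 1 →
      u x = k x.1 (Set.projIcc 0 1 zero_le_one x.2) := fun x hx => if_pos hx
  have hu2 : ∀ x : (Fin n → ℝ) × ℝ, x.2 = 0 ∨ x.2 = 1 → u x = g (φ x.1) := by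
    intro x hx
    by_cases h : ‖x.1‖ = 1
    · rw [hu1 x h]
      have := hk x.1 (mem_sphere_zero_iff_norm.2 h)
      rcases hx with hx | hx <;> rw [hx]
      · rw [Set.projIcc_left]; exact this.1
      · rw [Set.projIcc_right]; exact this.2
    · exact if_neg h
  have hu : ContinuousOn u (cylinderBoundary (Fin n → ℝ)) := by
    refine ContinuousOn.mono (s := (sphere (0 : Fin n → ℝ) 1 ×ˢ Set.univ) ∪
      (closedBall (0 : Fin n → ℝ) 1 ×ˢ ({0, 1} : Set ℝ))) ?_ ?_
    · refine ContinuousOn.union_of_isClosed ?_ ?_ (isClosed_sphere.prod isClosed_univ)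
        (isClosed_closedBall.prod (Set.toFinite _).isClosed)
      · refine ContinuousOn.congr
          (f := fun x => k x.1 (Set.projIcc 0 1 zero_le_one x.2)) ?_
          fun x hx => hu1 x (mem_sphere_zero_iff_norm.1 hx.1)
        have h1 : ContinuousOn (fun x : (Fin n → ℝ) × ℝ => k x.1)
            (sphere (0 : Fin n → ℝ) 1 ×ˢ Set.univ) :=
          hkc.comp continuousOn_fst fun x hx => hx.1
        have h2 : Continuous (fun x : (Fin n → ℝ) × ℝ =>
            (Set.projIcc 0 1 zero_le_one x.2 : I)) := continuous_projIcc.comp continuous_snd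
        exact continuous_eval.comp_continuousOn (h1.prodMk h2.continuousOn)
      · refine ContinuousOn.congr (f := fun x => g (φ x.1)) ?_ fun x hx => hu2 x hx.2
        exact g.continuous.comp_continuousOn (hφ.comp continuousOn_fst fun x hx => hx.1)
    · rintro x ⟨h1, h2, h3 | h3⟩
      · exact Or.inl ⟨mem_sphere_zero_iff_norm.2 h3, trivial⟩
      · exact Or.inr ⟨mem_closedBall_zero_iff.2 h1, h3⟩
  obtain ⟨K, hK⟩ := exists_filler_of_pi hn hπ u hu
  refine ⟨K, fun v => ?_, fun v => ?_, fun v t hv => ?_⟩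
  · exact (hK v 0 ⟨mem_closedBall_zero_iff.1 v.2, (0 : I).2, Or.inr (Or.inl rfl)⟩).trans
      (hu2 _ (Or.inl rfl))
  · exact (hK v 1 ⟨mem_closedBall_zero_iff.1 v.2, (1 : I).2, Or.inr (Or.inr rfl)⟩).trans
      (hu2 _ (Or.inr rfl))
  · refine (hK v t ⟨hv.le, t.2, Or.inl hv⟩).trans ((hu1 _ hv).trans ?_)
    exact congrArg _ (Set.projIcc_val zero_le_one t)

open Topology in
/-- A map from a path-connected CW complex to a path-connected space without higher homotopy groups
has a self-homotopy along every loop whose class commutes with the image of the fundamental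
group. -/
theorem exists_homotopy_of_commute_of_cwComplex [T2Space Y] [CWComplex (Set.univ : Set Y)]
    [PathConnectedSpace X] {x₀ : X}
    (hπ : ∀ m : ℕ, 2 ≤ m → Subsingleton (HomotopyGroup.Pi m X x₀))
    (hd : ∀ l, d ≫ pushArrow g l = pushArrow g l ≫ d) :
    ∃ H : g.Homotopy g, Path.Homotopic.Quotient.mk (H.evalAt y₀) = d := by
  have : Nonempty C(I, X) := ⟨ContinuousMap.const I x₀⟩
  obtain ⟨h, hh⟩ := exists_section_of_cells (IsTransported g d) fun n i k hkc hk => by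
    have hφ := RelCWComplex.continuousOn n i
    rcases eq_or_ne n 0 with rfl | hn
    · obtain ⟨z, hz⟩ := exists_isTransported hd (RelCWComplex.map 0 i 0)
      refine ⟨fun _ => z, continuousOn_const, fun x hx => ?_, fun x _ => ?_⟩
      · rw [sphere_eq_empty_of_subsingleton one_ne_zero] at hx
        exact hx.elim
      · rwa [Subsingleton.elim x 0]
    · obtain ⟨K, hK0, hK1, hK⟩ : ∃ K : C(closedBall (0 : Fin n → ℝ) 1 × I, X),
          (∀ v, K (v, 0) = g (RelCWComplex.map n i v)) ∧ (∀ v, K (v, 1) = g (RelCWComplex.map n i v)) ∧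
          ∀ (v : closedBall (0 : Fin n → ℝ) 1) t, ‖(v : Fin n → ℝ)‖ = 1 → K (v, t) = k v t := by
        rcases eq_or_ne n 1 with rfl | hn1
        · exact exists_filler_interval hφ hk
        · exact exists_filler_cell hn (hπ n (by omega)) hφ hkc
            fun x hx => let ⟨h0, h1, _⟩ := hk x hx; ⟨h0, h1⟩
      exact exists_extension_of_filler hd hn hφ hk K hK0 hK1 hK
  let H : g.Homotopy g :=
    { toFun := fun x => h x.2 x.1
      continuous_toFun := by fun_prop
      map_zero_left := fun y => (hh y).choose
      map_one_left := fun y => (hh y).choose_spec.choose }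
  refine ⟨H, ?_⟩
  obtain ⟨h0, h1, hq⟩ := hh y₀
  -- The constant path shows that the loop at `y₀` has class exactly `d`; `y₀` need not be a vertex.
  have e := hq (𝟙 _)
  rw [pushArrow_id] at e
  have e' : d = loopArrow (h y₀) h0 h1 := by simpa using e
  exact e'.symm

end Extension

/-! ### Homotopy invariance and the centralizer -/

section Main

open CategoryTheory

variable {A X : Type*} [TopologicalSpace A] [TopologicalSpace X]

/-- The class of a path as an arrow of the fundamental groupoid. -/
def pathArrow {x y : X} (p : Path x y) : FundamentalGroupoid.mk x ⟶ FundamentalGroupoid.mk y :=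
  Path.Homotopic.Quotient.mk p

theorem pathArrow_trans {x y z : X} (p : Path x y) (q : Path y z) :
    pathArrow (p.trans q) = pathArrow p ≫ pathArrow q :=
  rfl

theorem pathArrow_symm {x y : X} (p : Path x y) : pathArrow p.symm = inv (pathArrow p) :=
  Groupoid.inv_eq_inv (pathArrow p)

theorem conj_comm_of_comm {C : Type*} [Groupoid C] {a b : C} {p : a ⟶ b} {d : b ⟶ b} {m : a ⟶ a}
    (h : d ≫ inv p ≫ m ≫ p = (inv p ≫ m ≫ p) ≫ d) :
    (p ≫ d ≫ inv p) ≫ m = m ≫ p ≫ d ≫ inv p := by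
  have h' := congrArg (fun z => p ≫ z ≫ inv p) h
  simpa using h'

theorem mapOfEq_id {x : X} (h : ContinuousMap.id X x = x) (γ : FundamentalGroup X x) :
    FundamentalGroup.mapOfEq (ContinuousMap.id X) h γ = γ := by
  rw [FundamentalGroup.mapOfEq_apply]
  obtain ⟨l, rfl⟩ := Path.Homotopic.Quotient.mk_surjective γ
  rfl

/-- A map from a path-connected space of the homotopy type of a CW complex to a path-connected space
without higher homotopy groups has a self-homotopy along every loop whose class commutes with the
image of the fundamental group. -/
theorem exists_homotopy_of_commute [PathConnectedSpace A] (hA : HasCWHomotopyType A)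
    [PathConnectedSpace X] {x₀ : X}
    (hπ : ∀ m : ℕ, 2 ≤ m → Subsingleton (HomotopyGroup.Pi m X x₀)) {f : C(A, X)} {a₀ : A}
    {d : FundamentalGroupoid.mk (f a₀) ⟶ FundamentalGroupoid.mk (f a₀)}
    (hd : ∀ l, d ≫ pushArrow f l = pushArrow f l ≫ d) :
    ∃ H : f.Homotopy f, pathArrow (H.evalAt a₀) = d := by
  obtain ⟨Y, _, _, ⟨_⟩, ⟨e⟩⟩ := hA
  obtain ⟨h⟩ := e.left_inv
  obtain ⟨h'⟩ := e.right_inv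
  have : PathConnectedSpace Y :=
    { nonempty := ⟨e a₀⟩
      joined := fun y y' => by
        have hj : ∀ z, Joined (e (e.invFun z)) z := fun z => ⟨h'.evalAt z⟩
        exact ((hj y).symm.trans ((PathConnectedSpace.joined _ _).map e.toFun.continuous)).trans
          (hj y') }
  let g : C(Y, X) := f.comp e.invFun
  let c : FundamentalGroupoid.mk (e.invFun (e.toFun a₀)) ⟶ FundamentalGroupoid.mk a₀ :=
    pathArrow (h.evalAt a₀)
  -- The homotopy `h` to the identity followed by `f`; its trace `p` at `a₀` is the change of base
  -- point.
  let L : (g.comp e.toFun).Homotopy f :=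
    { toFun := fun x => f (h x)
      continuous_toFun := by fun_prop
      map_zero_left := fun a => congrArg f (h.map_zero_left a)
      map_one_left := fun a => congrArg f (h.map_one_left a) }
  let p : FundamentalGroupoid.mk (g (e.toFun a₀)) ⟶ FundamentalGroupoid.mk (f a₀) :=
    pathArrow (L.evalAt a₀)
  have hp : p = pushArrow f c := rfl
  have hd' : ∀ l, (p ≫ d ≫ inv p) ≫ pushArrow g l = pushArrow g l ≫ (p ≫ d ≫ inv p) := by
    intro l
    let l' : FundamentalGroupoid.mk (e.invFun (e.toFun a₀)) ⟶ .mk (e.invFun (e.toFun a₀)) :=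
      pushArrow e.invFun l
    have hl : pushArrow g l = pushArrow f l' := Path.Homotopic.Quotient.map_comp
    have key := hd (inv c ≫ l' ≫ c)
    rw [pushArrow_comp, pushArrow_comp, pushArrow_inv, ← hp, ← hl] at key
    exact conj_comm_of_comm key
  obtain ⟨H, hH⟩ := exists_homotopy_of_commute_of_cwComplex (g := g) (y₀ := e.toFun a₀) hπ hd'
  let H' : (g.comp e.toFun).Homotopy (g.comp e.toFun) :=
    { toFun := fun x => H (x.1, e.toFun x.2)
      continuous_toFun := by fun_prop
      map_zero_left := fun a => H.map_zero_left _
      map_one_left := fun a => H.map_one_left _ }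
  have hH' : pathArrow (H'.evalAt a₀) = p ≫ d ≫ inv p := hH
  -- `H'` traces `p ≫ d ≫ inv p`; conjugating by `L` undoes the change of base point.
  refine ⟨(L.symm.trans H').trans L, ?_⟩
  have hL : L.symm.evalAt a₀ = (L.evalAt a₀).symm := rfl
  rw [evalAt_trans, evalAt_trans, pathArrow_trans, pathArrow_trans, hL, pathArrow_symm, hH']
  change (inv p ≫ p ≫ d ≫ inv p) ≫ p = d
  simp

theorem mem_generalizedGottliebGroup_iff [PathConnectedSpace A] (hA : HasCWHomotopyType A)
    [PathConnectedSpace X] {x₀ : X}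
    (hπ : ∀ m : ℕ, 2 ≤ m → Subsingleton (HomotopyGroup.Pi m X x₀)) {a₀ : A} (f : C(A, X))
    (hf : f a₀ = x₀) (γ : FundamentalGroup X x₀) :
    γ ∈ generalizedGottliebGroup f hf ↔
      ∀ l, FundamentalGroup.mapOfEq f hf l * γ = γ * FundamentalGroup.mapOfEq f hf l := by
  refine (mem_gottliebSet_iff f hf γ).trans ?_
  subst hf
  simp only [FundamentalGroup.mapOfEq_apply, Path.Homotopic.Quotient.cast_rfl_rfl]
  constructor
  · rintro ⟨H, rfl⟩ l
    obtain ⟨l, rfl⟩ := Path.Homotopic.Quotient.mk_surjective l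
    exact Path.Homotopic.Quotient.eq.2 (Path.Homotopic.map_trans_evalAt H l).symm
  · intro h
    -- Products in the fundamental group compose arrows in reverse order, so `h` is literally the
    -- commutation required of `d`.
    exact exists_homotopy_of_commute hA hπ h

theorem map_generalizedGottliebGroup_eq_centralizer [PathConnectedSpace A]
    (hA : HasCWHomotopyType A) {π : Type*} [Group π] {x₀ : X} (K : EilenbergMacLaneOne π X x₀)
    {a₀ : A} (f : C(A, X)) (hf : f a₀ = x₀) :
    (generalizedGottliebGroup f hf).map K.iso.toMonoidHom =
      Subgroup.centralizer
        ((FundamentalGroup.mapOfEq f hf).range.map K.iso.toMonoidHom : Set π) := by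
  have := K.pathConnected
  ext z
  obtain ⟨γ, rfl⟩ := K.iso.surjective z
  have h1 : K.iso γ ∈ (generalizedGottliebGroup f hf).map K.iso.toMonoidHom ↔
      γ ∈ generalizedGottliebGroup f hf :=
    Subgroup.mem_map_iff_mem K.iso.injective
  rw [h1, mem_generalizedGottliebGroup_iff hA K.higher, Subgroup.mem_centralizer_iff]
  constructor
  · rintro h _ ⟨_, ⟨l, rfl⟩, rfl⟩
    change K.iso _ * K.iso _ = K.iso _ * K.iso _
    rw [← map_mul, h, map_mul]
  · intro h l
    have := h _ ⟨_, ⟨l, rfl⟩, rfl⟩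
    change K.iso _ * K.iso _ = K.iso _ * K.iso _ at this
    rw [← map_mul, ← map_mul] at this
    exact K.iso.injective this

end Main

end GenGottlieb

theorem mainTheorem4 {π : Type*} [Group π] {X : Type*} [TopologicalSpace X] (x₀ : X)
    (hX : GenGottlieb.HasCWHomotopyType X) (K : GenGottlieb.EilenbergMacLaneOne π X x₀) :
    (∀ (A : Type*) [TopologicalSpace A] [PathConnectedSpace A],
      GenGottlieb.HasCWHomotopyType A →
      ∀ (a₀ : A) (f : C(A, X)) (hf : f a₀ = x₀),
        (GenGottlieb.generalizedGottliebGroup f hf).map K.iso.toMonoidHom =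
          Subgroup.centralizer
            ((FundamentalGroup.mapOfEq f hf).range.map K.iso.toMonoidHom : Set π)) ∧
    (GenGottlieb.gottliebGroup X x₀).map K.iso.toMonoidHom = Subgroup.center π := by
  refine ⟨fun A _ _ hA a₀ f hf =>
    GenGottlieb.map_generalizedGottliebGroup_eq_centralizer hA K f hf, ?_⟩
  have := K.pathConnected
  refine (GenGottlieb.map_generalizedGottliebGroup_eq_centralizer hX K (ContinuousMap.id X)
    rfl).trans ?_
  -- For the identity the image of the fundamental group is all of `π`, and the centralizer of
  -- everything is the center.
  rw [← Subgroup.centralizer_univ]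
  congr 1
  refine Set.eq_univ_of_forall fun z => ?_
  obtain ⟨γ, rfl⟩ := K.iso.surjective z
  exact ⟨γ, ⟨γ, GenGottlieb.mapOfEq_id rfl γ⟩, rfl⟩
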